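/- Let $M$ be a closed connected smooth manifold with a smooth Riemannian metric $g$, let $\Pi:\widetilde M\to M$ be its universal covering, and let $\Omega$ be a smooth 2-form on $M$ that is weakly exact, i.e. $\Pi^*\Omega=d\theta$ for some smooth 1-form $\theta$ on $\widetilde M$. For such a primitive $\theta$ let $L(x,v)=\tfrac12|v|_x^2-\theta_x(v)$ on $T\widetilde M$, where $|\cdot|$ is the norm of the lifted metric $\Pi^*g$, and for an absolutely continuous curve $\gamma:[0,T]\to\widetilde M$ and $k\in\mathbb R$ let $$A_{L+k}(\gamma)=\int_0^T\bigl(L(\gamma(t),\dot\gamma(t))+k\bigr)\,dt\in(-\infty,+\infty].$$ The Mañé critical value of $(g,\Omega)$ is $$c(g,\Omega)=\inf\{k\in\mathbb R:\ A_{L+k}(\gamma)\ge 0\ \text{for every absolutely continuous closed curve } \gamma:[0,T]\to\widetilde M,\ T>0\},$$ with $\inf\emptyset=+\infty$. If the group $\pi_1(M)$ is amenable (that is, the space of bounded functions $\pi_1(M)\to\mathbb R$ has a left invariant mean) and $\Omega$ is not exact, then $c(g,\Omega)=+\infty$, whichever primitive $\theta$ of $\Pi^*\Omega$ is used to compute it.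 -/

import Mathlib

open scoped Manifold ContDiff Topology

noncomputable section

/-! ### Amenable discrete groups -/

/-- The space `ℓ^∞(Γ)` of bounded real functions on a set `Γ`. -/
def boundedFunctions (Γ : Type*) : Submodule ℝ (Γ → ℝ) where
  carrier := {a | ∃ C : ℝ, ∀ γ, |a γ| ≤ C}
  add_mem' := by
    rintro a b ⟨C, hC⟩ ⟨D, hD⟩
    exact ⟨C + D, fun γ => (abs_add_le _ _).trans (add_le_add (hC γ) (hD γ))⟩
  zero_mem' := ⟨0, fun γ => by simp⟩
  smul_mem' := by
    rintro c a ⟨C, hC⟩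
    refine ⟨|c| * C, fun γ => ?_⟩
    simpa [abs_mul] using mul_le_mul_of_nonneg_left (hC γ) (abs_nonneg c)

/-- A discrete group is amenable if the space of bounded real functions on it carries a
left invariant mean: a linear functional that is monotone, equal to `1` on the constant
function `1`, and invariant under left translations of the argument. -/
def IsAmenableGroup (Γ : Type*) [Group Γ] : Prop :=
  ∃ m : boundedFunctions Γ →ₗ[ℝ] ℝ,
    (∀ a : boundedFunctions Γ, (∀ γ, a.1 γ = 1) → m a = 1) ∧
    (∀ a b : boundedFunctions Γ, (∀ γ, a.1 γ ≤ b.1 γ) → m a ≤ m b) ∧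
    (∀ (h : Γ) (a b : boundedFunctions Γ), (∀ γ, b.1 γ = a.1 (h * γ)) → m b = m a)

/-! ### Differential forms on manifolds without boundary

The model space is `EuclideanSpace ℝ (Fin n)`, so charts have open targets. -/

section Forms

variable {n : ℕ}
  {M : Type*} [TopologicalSpace M] [ChartedSpace (EuclideanSpace ℝ (Fin n)) M]
  {N : Type*} [TopologicalSpace N] [ChartedSpace (EuclideanSpace ℝ (Fin n)) N]

variable (n M) in
/-- A (not necessarily smooth) differential `k`-form: an alternating `k`-linear form on each
tangent space. -/
abbrev DiffForm (k : ℕ) : Type _ :=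
  ∀ x : M, (TangentSpace (𝓡 n) x) [⋀^Fin k]→L[ℝ] ℝ

/-- The form `η` written in the chart around `x₀`, i.e. its pullback under the inverse chart.
It is meaningful on the target of the chart. -/
def DiffForm.inChart {k : ℕ} (η : DiffForm n M k) (x₀ : M) (y : EuclideanSpace ℝ (Fin n)) :
    (EuclideanSpace ℝ (Fin n)) [⋀^Fin k]→L[ℝ] ℝ :=
  (η ((extChartAt (𝓡 n) x₀).symm y)).compContinuousLinearMap
    (mfderiv 𝓘(ℝ, EuclideanSpace ℝ (Fin n)) (𝓡 n) (extChartAt (𝓡 n) x₀).symm y)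

/-- A form is smooth if its expression in every chart is smooth. -/
def DiffForm.IsSmooth {k : ℕ} (η : DiffForm n M k) : Prop :=
  ∀ x₀ : M, ContDiffOn ℝ ∞ (η.inChart x₀) (extChartAt (𝓡 n) x₀).target

/-- The exterior derivative `dη`: at `x` it is computed in the chart around `x`. -/
def DiffForm.d {k : ℕ} (η : DiffForm n M k) : DiffForm n M (k + 1) := fun x =>
  (extDeriv (η.inChart x) (extChartAt (𝓡 n) x x)).compContinuousLinearMap
    (mfderiv (𝓡 n) 𝓘(ℝ, EuclideanSpace ℝ (Fin n)) (extChartAt (𝓡 n) x) x)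

/-- The pullback `f^* η` of a form. -/
def DiffForm.pullback {k : ℕ} (f : N → M) (η : DiffForm n M k) : DiffForm n N k := fun x =>
  (η (f x)).compContinuousLinearMap (mfderiv (𝓡 n) (𝓡 n) f x)

/-- `θ` is a (smooth) primitive of `η`. -/
def DiffForm.IsPrimitive {k : ℕ} (θ : DiffForm n M k) (η : DiffForm n M (k + 1)) : Prop :=
  θ.IsSmooth ∧ θ.d = η

/-- `η` is exact: it has a smooth primitive. -/
def DiffForm.IsExact {k : ℕ} (η : DiffForm n M (k + 1)) : Prop :=
  ∃ θ : DiffForm n M k, θ.IsPrimitive η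

end Forms

/-! ### Universal coverings and the Mañé critical value -/

section Critical

variable {n : ℕ}
  {M : Type*} [TopologicalSpace M] [ChartedSpace (EuclideanSpace ℝ (Fin n)) M]
  {N : Type*} [TopologicalSpace N] [ChartedSpace (EuclideanSpace ℝ (Fin n)) N]

variable (n) in
/-- `p : N → M` is the (smooth) universal covering of `M`: a covering map with simply connected
total space, which carries the smooth structure making `p` a local diffeomorphism. -/
structure IsUniversalCovering (p : N → M) : Prop where
  simplyConnected : SimplyConnectedSpace N
  isCoveringMap : IsCoveringMap p
  isLocalDiffeomorph : IsLocalDiffeomorph (𝓡 n) (𝓡 n) ∞ p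

/-- With respect to the universal covering `p : N → M`, the form `Ω` on `M` is weakly exact
if its lift to `N` is exact. -/
def DiffForm.IsWeaklyExact {k : ℕ} (p : N → M) (Ω : DiffForm n M (k + 1)) : Prop :=
  (Ω.pullback p).IsExact

variable (n) in
/-- `γ` restricted to `[0, T]` is an absolutely continuous curve in the manifold `N`:
it is continuous, and on each subinterval that it maps into a chart, its coordinate expression
is absolutely continuous. -/
def IsAbsContCurve (γ : ℝ → N) (T : ℝ) : Prop :=
  ContinuousOn γ (Set.Icc 0 T) ∧
  ∀ (x₀ : N) (a b : ℝ), 0 ≤ a → a ≤ b → b ≤ T →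
    Set.MapsTo γ (Set.Icc a b) (extChartAt (𝓡 n) x₀).source →
    AbsolutelyContinuousOnInterval (fun t => extChartAt (𝓡 n) x₀ (γ t)) a b

variable (n) in
/-- The velocity `γ'(t)` (which exists at almost every time for an absolutely continuous `γ`). -/
def velocity (γ : ℝ → N) (t : ℝ) : TangentSpace (𝓡 n) (γ t) :=
  mfderiv 𝓘(ℝ, ℝ) (𝓡 n) γ t (1 : ℝ)

variable [IsManifold (𝓡 n) ∞ M]

variable (n M) in
/-- Smooth Riemannian metrics on `M`. -/
abbrev RiemMetric : Type _ :=
  Bundle.ContMDiffRiemannianMetric (𝓡 n) ∞ (EuclideanSpace ℝ (Fin n))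
    (TangentSpace (𝓡 n) : M → Type _)

/-- The Lagrangian `L(x, v) = |v|²/2 - θ_x(v)` on `N`, where `|·|` is the norm of the lift
`p^* g` of the metric `g` on `M`. -/
def magneticLagrangian (g : RiemMetric n M) (p : N → M) (θ : DiffForm n N 1)
    (x : N) (v : TangentSpace (𝓡 n) x) : ℝ :=
  (1 / 2) * g.inner (p x) (mfderiv (𝓡 n) (𝓡 n) p x v) (mfderiv (𝓡 n) (𝓡 n) p x v)
    - θ x (fun _ => v)

open Classical in
/-- The action `A_{L+k}(γ) = ∫_0^T (L(γ, γ') + k) dt` of an absolutely continuous curve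
`γ : [0, T] → N`. As `L` is bounded below along such a curve, the action is a well-defined
element of `(-∞, +∞]`, which is `+∞` precisely if the integrand is not integrable. -/
def magneticAction (g : RiemMetric n M) (p : N → M) (θ : DiffForm n N 1) (k : ℝ)
    (γ : ℝ → N) (T : ℝ) : EReal :=
  if MeasureTheory.IntegrableOn
      (fun t => magneticLagrangian g p θ (γ t) (velocity n γ t) + k) (Set.Icc 0 T) then
    ((∫ t in Set.Icc 0 T, (magneticLagrangian g p θ (γ t) (velocity n γ t) + k) : ℝ) : EReal)
  else ⊤

/-- The Mañé critical value, computed with the primitive `θ` of the lift of the magnetic form: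
the infimum in `[-∞, +∞]` (which is `+∞` for the empty set) of all real `k` such that
`A_{L+k}(γ) ≥ 0` for all absolutely continuous closed curves `γ : [0, T] → N`. -/
def maneCriticalValue (g : RiemMetric n M) (p : N → M) (θ : DiffForm n N 1) : EReal :=
  sInf ((fun k : ℝ => (k : EReal)) '' {k : ℝ | ∀ (T : ℝ) (γ : ℝ → N), 0 < T →
    IsAbsContCurve n γ T → γ 0 = γ T → 0 ≤ magneticAction g p θ k γ T})

end Critical

end

/-! Suppose some real `k` has nonnegative action on all closed curves; then `Ω` is exact. For a deck
transformation `h`, the form `h^*θ - θ` is closed, because `θ` is a primitive of a lifted form, so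
it equals `df_h` on the simply connected cover. The kinetic part of the Lagrangian is invariant
under `h`, hence replacing a curve from `x` to `y` by its image under `h` changes the action by
`-(f_h(y) - f_h(x))` only.

Let `u(x)` be the infimum of the actions of curves from a base point `e` to `x`; it is finite since
closing up a curve gives nonnegative action. Comparing `u(hx)` and `u(hy)` along the images of two
fixed curves, one from `x` to `y` and one back, bounds `(f_h + u ∘ h)(y) - (f_h + u ∘ h)(x)`
uniformly in `h` (`exists_potential`). This uniform bound is what amenability needs: a mean over `h`
of these differences, based at `e`, defines `w(x)`. Since `f_{hg} = f_h ∘ g + f_g` up to constants,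
invariance of the mean gives `w ∘ g = w - f_g + c_g` (`exists_averaged_primitive`).

Nothing makes `w` regular, but its changes `f_g` are smooth, so a partition of unity on `M` replaces
it by a smooth function with the same transformation law (`exists_smooth_of_smooth_change`). Then `θ
+ dw` is deck invariant and descends to a form `α` on `M`. The lifts of `dα` and `Ω` agree, so `dα =
Ω`. -/

noncomputable section

/-! ### Calculus of differential forms in charts -/

section FormCalculus

variable {n : ℕ}
  {M : Type*} [TopologicalSpace M] [ChartedSpace (EuclideanSpace ℝ (Fin n)) M]
  [IsManifold (𝓡 n) ∞ M]
  {N : Type*} [TopologicalSpace N] [ChartedSpace (EuclideanSpace ℝ (Fin n)) N]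
  [IsManifold (𝓡 n) ∞ N]
  {k : ℕ}

namespace DiffForm

-- Values of a form at `a` and `b` live on different tangent spaces; regarding both as the model
-- space makes a change of base point expressible without casts.
omit [IsManifold (𝓡 n) ∞ M] in
theorem comp_congr (η : DiffForm n M k) {a b : M} (h : a = b)
    (L L' : EuclideanSpace ℝ (Fin n) →L[ℝ] EuclideanSpace ℝ (Fin n)) (hL : L = L') :
    (ContinuousAlternatingMap.compContinuousLinearMap (η a) L :
      EuclideanSpace ℝ (Fin n) [⋀^Fin k]→L[ℝ] ℝ) =
    ContinuousAlternatingMap.compContinuousLinearMap (η b) L' := by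
  subst h; subst hL; rfl

/-- Near `y`, `f ∘ φ⁻¹ = ψ⁻¹ ∘ (ψ ∘ f ∘ φ⁻¹)` for the two charts `φ`, `ψ`; the chain rule on both
sides gives the formula. It reduces all statements about pullbacks to vector spaces. -/
theorem pullback_inChart (f : N → M) (η : DiffForm n M k) (x₀ : N) (y₀ : M)
    {y : EuclideanSpace ℝ (Fin n)} (hy : y ∈ (extChartAt (𝓡 n) x₀).target)
    (hf : MDifferentiableAt (𝓡 n) (𝓡 n) f ((extChartAt (𝓡 n) x₀).symm y))
    (hfy : f ((extChartAt (𝓡 n) x₀).symm y) ∈ (extChartAt (𝓡 n) y₀).source) :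
    (η.pullback f).inChart x₀ y =
      (η.inChart y₀ (extChartAt (𝓡 n) y₀ (f ((extChartAt (𝓡 n) x₀).symm y)))).compContinuousLinearMap
        (fderiv ℝ (extChartAt (𝓡 n) y₀ ∘ f ∘ (extChartAt (𝓡 n) x₀).symm) y) := by
  have hφ : MDifferentiableAt 𝓘(ℝ, EuclideanSpace ℝ (Fin n)) (𝓡 n) (extChartAt (𝓡 n) x₀).symm y :=
    ((contMDiffOn_extChartAt_symm (n := ∞) x₀).contMDiffAt
      ((isOpen_extChartAt_target x₀).mem_nhds hy)).mdifferentiableAt (by simp)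
  have hψ : MDifferentiableAt (𝓡 n) 𝓘(ℝ, EuclideanSpace ℝ (Fin n)) (extChartAt (𝓡 n) y₀)
      (f ((extChartAt (𝓡 n) x₀).symm y)) :=
    (contMDiffAt_extChartAt' (n := ∞) (by simpa using hfy)).mdifferentiableAt (by simp)
  have hψ' : MDifferentiableAt 𝓘(ℝ, EuclideanSpace ℝ (Fin n)) (𝓡 n) (extChartAt (𝓡 n) y₀).symm
      (extChartAt (𝓡 n) y₀ (f ((extChartAt (𝓡 n) x₀).symm y))) :=
    ((contMDiffOn_extChartAt_symm (n := ∞) y₀).contMDiffAt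
      ((isOpen_extChartAt_target y₀).mem_nhds
        ((extChartAt (𝓡 n) y₀).map_source hfy))).mdifferentiableAt (by simp)
  have hF : MDifferentiableAt 𝓘(ℝ, EuclideanSpace ℝ (Fin n)) 𝓘(ℝ, EuclideanSpace ℝ (Fin n))
      (extChartAt (𝓡 n) y₀ ∘ f ∘ (extChartAt (𝓡 n) x₀).symm) y :=
    hψ.comp y (hf.comp y hφ)
  have key : mfderiv (𝓡 n) (𝓡 n) f ((extChartAt (𝓡 n) x₀).symm y) ∘L
      mfderiv 𝓘(ℝ, EuclideanSpace ℝ (Fin n)) (𝓡 n) (extChartAt (𝓡 n) x₀).symm y =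
      mfderiv 𝓘(ℝ, EuclideanSpace ℝ (Fin n)) (𝓡 n) (extChartAt (𝓡 n) y₀).symm
        (extChartAt (𝓡 n) y₀ (f ((extChartAt (𝓡 n) x₀).symm y))) ∘L
      mfderiv 𝓘(ℝ, EuclideanSpace ℝ (Fin n)) 𝓘(ℝ, EuclideanSpace ℝ (Fin n))
        (extChartAt (𝓡 n) y₀ ∘ f ∘ (extChartAt (𝓡 n) x₀).symm) y := by
    rw [← mfderiv_comp y hf hφ]
    refine Eq.trans ?_ (mfderiv_comp y (g := (extChartAt (𝓡 n) y₀).symm) hψ' hF)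
    apply Filter.EventuallyEq.mfderiv_eq
    have hcont : ContinuousAt (f ∘ (extChartAt (𝓡 n) x₀).symm) y := (hf.comp y hφ).continuousAt
    filter_upwards [hcont.preimage_mem_nhds ((isOpen_extChartAt_source y₀).mem_nhds hfy)] with z hz
    exact ((extChartAt (𝓡 n) y₀).left_inv hz).symm
  rw [← mfderiv_eq_fderiv]
  exact comp_congr η ((extChartAt (𝓡 n) y₀).left_inv hfy).symm _ _ key

theorem minSmoothness_two_le_infty : minSmoothness ℝ 2 ≤ (∞ : WithTop ℕ∞) := by
  rw [minSmoothness_of_isRCLikeNormedField]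
  exact WithTop.coe_le_coe.2 (le_top : (2 : ℕ∞) ≤ ⊤)

theorem contDiffAt_compContinuousLinearMap_one {m : WithTop ℕ∞}
    {E : Type*} [NormedAddCommGroup E] [NormedSpace ℝ E]
    {τ : E → E [⋀^Fin 1]→L[ℝ] ℝ} {L : E → E →L[ℝ] E} {y : E}
    (hτ : ContDiffAt ℝ m τ y) (hL : ContDiffAt ℝ m L y) :
    ContDiffAt ℝ m (fun z => (τ z).compContinuousLinearMap (L z)) y := by
  let J := ContinuousAlternatingMap.ofSubsingletonLIE (𝕜 := ℝ) (E := E) (F := ℝ) (0 : Fin 1)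
  have h1 : (fun z => (τ z).compContinuousLinearMap (L z)) =
      fun z => J ((J.symm (τ z)).comp (L z)) := by
    funext z
    obtain ⟨a, ha⟩ := J.surjective (τ z)
    rw [← ha, J.symm_apply_apply]
    ext v
    rfl
  rw [h1]
  exact J.contDiff.contDiffAt.comp y ((J.symm.contDiff.contDiffAt.comp y hτ).clm_comp hL)

/-- Smoothness of a form at a point, read in the chart around that point. -/
def IsSmoothAt (η : DiffForm n M k) (x : M) : Prop :=
  ContDiffAt ℝ ∞ (η.inChart x) (extChartAt (𝓡 n) x x)

theorem contDiffAt_chart_comp {f : N → M} {x₀ : N} {y₀ : M}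
    {y : EuclideanSpace ℝ (Fin n)} (hy : y ∈ (extChartAt (𝓡 n) x₀).target)
    (hf : ContMDiffAt (𝓡 n) (𝓡 n) ∞ f ((extChartAt (𝓡 n) x₀).symm y))
    (hfy : f ((extChartAt (𝓡 n) x₀).symm y) ∈ (extChartAt (𝓡 n) y₀).source) :
    ContDiffAt ℝ ∞ (extChartAt (𝓡 n) y₀ ∘ f ∘ (extChartAt (𝓡 n) x₀).symm) y := by
  have hφ : ContMDiffAt 𝓘(ℝ, EuclideanSpace ℝ (Fin n)) (𝓡 n) ∞ (extChartAt (𝓡 n) x₀).symm y :=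
    (contMDiffOn_extChartAt_symm (n := ∞) x₀).contMDiffAt
      ((isOpen_extChartAt_target x₀).mem_nhds hy)
  have hψ : ContMDiffAt (𝓡 n) 𝓘(ℝ, EuclideanSpace ℝ (Fin n)) ∞ (extChartAt (𝓡 n) y₀)
      (f ((extChartAt (𝓡 n) x₀).symm y)) :=
    contMDiffAt_extChartAt' (n := ∞) (by simpa using hfy)
  exact (hψ.comp y (hf.comp y hφ)).contDiffAt

theorem pullback_inChart_eventuallyEq {f : N → M} (η : DiffForm n M k) {x₀ : N} {y₀ : M}
    {y : EuclideanSpace ℝ (Fin n)} (hy : y ∈ (extChartAt (𝓡 n) x₀).target)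
    (hf : ContMDiffAt (𝓡 n) (𝓡 n) ∞ f ((extChartAt (𝓡 n) x₀).symm y))
    (hfy : f ((extChartAt (𝓡 n) x₀).symm y) ∈ (extChartAt (𝓡 n) y₀).source) :
    (η.pullback f).inChart x₀ =ᶠ[𝓝 y] fun z =>
      (η.inChart y₀ ((extChartAt (𝓡 n) y₀ ∘ f ∘ (extChartAt (𝓡 n) x₀).symm)
        z)).compContinuousLinearMap
        (fderiv ℝ (extChartAt (𝓡 n) y₀ ∘ f ∘ (extChartAt (𝓡 n) x₀).symm) z) := by
  have hφ : ContinuousAt (extChartAt (𝓡 n) x₀).symm y := continuousAt_extChartAt_symm'' hy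
  have hev : ∀ᶠ w in 𝓝 ((extChartAt (𝓡 n) x₀).symm y), ContMDiffAt (𝓡 n) (𝓡 n) 1 f w :=
    (contMDiffAt_iff_contMDiffAt_nhds (by simp)).1 (hf.of_le (by simp))
  filter_upwards [(isOpen_extChartAt_target x₀).mem_nhds hy, hφ.eventually hev,
    (hf.continuousAt.comp hφ).preimage_mem_nhds
      ((isOpen_extChartAt_source y₀).mem_nhds hfy)] with z hz1 hz2 hz3
  exact pullback_inChart f η x₀ y₀ hz1 (hz2.mdifferentiableAt (by simp)) hz3

theorem contDiffAt_inChart_pullback {f : N → M} {η : DiffForm n M 1} {x₀ : N} {y₀ : M}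
    {y : EuclideanSpace ℝ (Fin n)} (hy : y ∈ (extChartAt (𝓡 n) x₀).target)
    (hf : ContMDiffAt (𝓡 n) (𝓡 n) ∞ f ((extChartAt (𝓡 n) x₀).symm y))
    (hfy : f ((extChartAt (𝓡 n) x₀).symm y) ∈ (extChartAt (𝓡 n) y₀).source)
    (hη : ContDiffAt ℝ ∞ (η.inChart y₀)
      (extChartAt (𝓡 n) y₀ (f ((extChartAt (𝓡 n) x₀).symm y)))) :
    ContDiffAt ℝ ∞ ((η.pullback f).inChart x₀) y := by
  have hF := contDiffAt_chart_comp hy hf hfy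
  refine ContDiffAt.congr_of_eventuallyEq ?_ (pullback_inChart_eventuallyEq η hy hf hfy)
  exact contDiffAt_compContinuousLinearMap_one (ContDiffAt.comp (g := η.inChart y₀) y hη hF)
    (hF.fderiv_right (m := ∞) (by simp))

theorem IsSmoothAt.pullback {f : N → M} {η : DiffForm n M 1} {x : N} (hη : η.IsSmoothAt (f x))
    (hf : ContMDiffAt (𝓡 n) (𝓡 n) ∞ f x) : (η.pullback f).IsSmoothAt x := by
  have e : (extChartAt (𝓡 n) x).symm (extChartAt (𝓡 n) x x) = x := extChartAt_to_inv x
  refine contDiffAt_inChart_pullback (y₀ := f x) (mem_extChartAt_target x) (by rwa [e]) ?_ ?_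
  · rw [e]; exact mem_extChartAt_source (f x)
  · rw [e]; exact hη

omit [IsManifold (𝓡 n) ∞ M] in
theorem pullback_id (η : DiffForm n M k) : η.pullback id = η := by
  funext x
  simp only [DiffForm.pullback, mfderiv_id]
  rfl

omit [IsManifold (𝓡 n) ∞ M] in
theorem IsSmooth.isSmoothAt {η : DiffForm n M k} (h : η.IsSmooth) (x : M) : η.IsSmoothAt x :=
  (h x).contDiffAt ((isOpen_extChartAt_target x).mem_nhds (mem_extChartAt_target x))

theorem isSmooth_iff {η : DiffForm n M 1} : η.IsSmooth ↔ ∀ x, η.IsSmoothAt x := by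
  refine ⟨fun h x => h.isSmoothAt x, fun h x₀ y hy => ContDiffAt.contDiffWithinAt ?_⟩
  have := contDiffAt_inChart_pullback (f := id) (η := η) (x₀ := x₀)
    (y₀ := (extChartAt (𝓡 n) x₀).symm y) hy contMDiffAt_id (mem_extChartAt_source _) (h _)
  rwa [pullback_id] at this

/-- In charts this is `extDeriv_pullback`; what remains is to match the chart derivatives by the
chain rule. -/
theorem d_pullback {f : N → M} {η : DiffForm n M k} {x : N} (hη : η.IsSmoothAt (f x))
    (hf : ContMDiffAt (𝓡 n) (𝓡 n) ∞ f x) : (η.pullback f).d x = η.d.pullback f x := by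
  have e : (extChartAt (𝓡 n) x).symm (extChartAt (𝓡 n) x x) = x := extChartAt_to_inv x
  have hy := mem_extChartAt_target (I := 𝓡 n) x
  have hf' : ContMDiffAt (𝓡 n) (𝓡 n) ∞ f
    ((extChartAt (𝓡 n) x).symm (extChartAt (𝓡 n) x x)) := by rwa [e]
  have hfy : f ((extChartAt (𝓡 n) x).symm (extChartAt (𝓡 n) x x)) ∈
    (extChartAt (𝓡 n) (f x)).source := by rw [e]; exact mem_extChartAt_source (f x)
  have hF := contDiffAt_chart_comp hy hf' hfy
  have hFx : (extChartAt (𝓡 n) (f x) ∘ f ∘ (extChartAt (𝓡 n) x).symm) (extChartAt (𝓡 n) x x) =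
    extChartAt (𝓡 n) (f x) (f x) := by simp only [Function.comp_apply, e]
  have h1 : extDeriv ((η.pullback f).inChart x) (extChartAt (𝓡 n) x x) =
      (extDeriv (η.inChart (f x)) (extChartAt (𝓡 n) (f x) (f x))).compContinuousLinearMap
        (fderiv ℝ (extChartAt (𝓡 n) (f x) ∘ f ∘ (extChartAt (𝓡 n) x).symm)
          (extChartAt (𝓡 n) x x)) := by
    rw [(pullback_inChart_eventuallyEq η hy hf' hfy).extDeriv_eq]
    have hd : DifferentiableAt ℝ (η.inChart (f x))
        ((extChartAt (𝓡 n) (f x) ∘ f ∘ (extChartAt (𝓡 n) x).symm) (extChartAt (𝓡 n) x x)) := by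
      rw [hFx]; exact hη.differentiableAt (by simp)
    rw [extDeriv_pullback hd hF minSmoothness_two_le_infty, hFx]
  have hmf : MDifferentiableAt (𝓡 n) (𝓡 n) f x := hf.mdifferentiableAt (by simp)
  have hψ : MDifferentiableAt (𝓡 n) 𝓘(ℝ, EuclideanSpace ℝ (Fin n)) (extChartAt (𝓡 n) (f x)) (f x) :=
    (contMDiffAt_extChartAt (n := ∞)).mdifferentiableAt (by simp)
  have hφ : MDifferentiableAt (𝓡 n) 𝓘(ℝ, EuclideanSpace ℝ (Fin n)) (extChartAt (𝓡 n) x) x :=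
    (contMDiffAt_extChartAt (n := ∞)).mdifferentiableAt (by simp)
  have hFm : MDifferentiableAt 𝓘(ℝ, EuclideanSpace ℝ (Fin n)) 𝓘(ℝ, EuclideanSpace ℝ (Fin n))
      (extChartAt (𝓡 n) (f x) ∘ f ∘ (extChartAt (𝓡 n) x).symm) (extChartAt (𝓡 n) x x) :=
    (hF.differentiableAt (by simp)).mdifferentiableAt
  have key : mfderiv 𝓘(ℝ, EuclideanSpace ℝ (Fin n)) 𝓘(ℝ, EuclideanSpace ℝ (Fin n))
        (extChartAt (𝓡 n) (f x) ∘ f ∘ (extChartAt (𝓡 n) x).symm) (extChartAt (𝓡 n) x x) ∘L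
        mfderiv (𝓡 n) 𝓘(ℝ, EuclideanSpace ℝ (Fin n)) (extChartAt (𝓡 n) x) x =
      mfderiv (𝓡 n) 𝓘(ℝ, EuclideanSpace ℝ (Fin n)) (extChartAt (𝓡 n) (f x)) (f x) ∘L
        mfderiv (𝓡 n) (𝓡 n) f x := by
    rw [← mfderiv_comp x hψ hmf]
    refine (mfderiv_comp x hFm hφ).symm.trans ?_
    apply Filter.EventuallyEq.mfderiv_eq
    filter_upwards [(isOpen_extChartAt_source (I := 𝓡 n) x).mem_nhds (mem_extChartAt_source x)]
      with z hz
    simp only [Function.comp_apply, (extChartAt (𝓡 n) x).left_inv hz]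
  rw [← mfderiv_eq_fderiv] at h1
  change (extDeriv ((η.pullback f).inChart x) (extChartAt (𝓡 n) x x)).compContinuousLinearMap _ = _
  rw [h1]
  exact congrArg ((extDeriv (η.inChart (f x))
    (extChartAt (𝓡 n) (f x) (f x))).compContinuousLinearMap) key

theorem inChart_model (τ : DiffForm n (EuclideanSpace ℝ (Fin n)) k)
    (x : EuclideanSpace ℝ (Fin n)) : τ.inChart x = τ := by
  funext y
  have e : ((extChartAt (𝓡 n) x).symm : EuclideanSpace ℝ (Fin n) → EuclideanSpace ℝ (Fin n)) =
    id := by simp [chartAt_self_eq]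
  unfold DiffForm.inChart
  rw [e, mfderiv_id]
  rfl

theorem d_model (τ : DiffForm n (EuclideanSpace ℝ (Fin n)) k) (x : EuclideanSpace ℝ (Fin n)) :
    τ.d x = extDeriv (fun y => (τ y : EuclideanSpace ℝ (Fin n) [⋀^Fin k]→L[ℝ] ℝ)) x := by
  have e : (extChartAt (𝓡 n) x : EuclideanSpace ℝ (Fin n) → EuclideanSpace ℝ (Fin n)) =
    id := by simp [chartAt_self_eq]
  unfold DiffForm.d
  rw [inChart_model, e, mfderiv_id]
  rfl

/-- Chart independence of `d`, whose definition uses a different chart at each point: it is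
naturality under the inverse chart, viewed as a map from the model space. -/
theorem extDeriv_inChart {η : DiffForm n M k} {x₀ : M} {y : EuclideanSpace ℝ (Fin n)}
    (hy : y ∈ (extChartAt (𝓡 n) x₀).target)
    (hη : η.IsSmoothAt ((extChartAt (𝓡 n) x₀).symm y)) :
    extDeriv (η.inChart x₀) y = η.d.inChart x₀ y := by
  have h := d_pullback (N := EuclideanSpace ℝ (Fin n)) (x := y) hη
    ((contMDiffOn_extChartAt_symm (n := ∞) x₀).contMDiffAt
      ((isOpen_extChartAt_target x₀).mem_nhds hy))
  rw [d_model] at h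
  exact h

theorem d_inChart_eventuallyEq {η : DiffForm n M k} (hη : ∀ x, η.IsSmoothAt x) (x : M) :
    η.d.inChart x =ᶠ[𝓝 (extChartAt (𝓡 n) x x)] extDeriv (η.inChart x) := by
  filter_upwards [(isOpen_extChartAt_target x).mem_nhds (mem_extChartAt_target (I := 𝓡 n) x)]
    with y hy
  exact (extDeriv_inChart hy (hη _)).symm

theorem d_d {η : DiffForm n M k} (hη : ∀ x, η.IsSmoothAt x) : η.d.d = 0 := by
  funext x
  change (extDeriv (η.d.inChart x) (extChartAt (𝓡 n) x x)).compContinuousLinearMap _ = 0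
  rw [(d_inChart_eventuallyEq hη x).extDeriv_eq,
    extDeriv_extDeriv_apply (hη x) minSmoothness_two_le_infty]
  rfl

omit [IsManifold (𝓡 n) ∞ M] in
theorem inChart_add (η ζ : DiffForm n M k) (x : M) :
    (η + ζ).inChart x = η.inChart x + ζ.inChart x := rfl

omit [IsManifold (𝓡 n) ∞ M] in
theorem inChart_sub (η ζ : DiffForm n M k) (x : M) :
    (η - ζ).inChart x = η.inChart x - ζ.inChart x := rfl

omit [IsManifold (𝓡 n) ∞ M] in
theorem IsSmoothAt.add {η ζ : DiffForm n M k} {x : M} (hη : η.IsSmoothAt x)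
    (hζ : ζ.IsSmoothAt x) : (η + ζ).IsSmoothAt x :=
  ContDiffAt.add hη hζ

omit [IsManifold (𝓡 n) ∞ M] in
theorem IsSmoothAt.sub {η ζ : DiffForm n M k} {x : M} (hη : η.IsSmoothAt x)
    (hζ : ζ.IsSmoothAt x) : (η - ζ).IsSmoothAt x :=
  ContDiffAt.sub hη hζ

omit [IsManifold (𝓡 n) ∞ M] in
theorem d_add {η ζ : DiffForm n M k} {x : M} (hη : η.IsSmoothAt x) (hζ : ζ.IsSmoothAt x) :
    (η + ζ).d x = η.d x + ζ.d x := by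
  change (extDeriv ((η + ζ).inChart x) (extChartAt (𝓡 n) x x)).compContinuousLinearMap _ = _
  rw [inChart_add, extDeriv_add (hη.differentiableAt (by simp)) (hζ.differentiableAt (by simp))]
  rfl

omit [IsManifold (𝓡 n) ∞ M] in
theorem d_sub {η ζ : DiffForm n M k} {x : M} (hη : η.IsSmoothAt x) (hζ : ζ.IsSmoothAt x) :
    (η - ζ).d x = η.d x - ζ.d x := by
  have h : extDeriv (η.inChart x - ζ.inChart x) (extChartAt (𝓡 n) x x) =
      extDeriv (η.inChart x) (extChartAt (𝓡 n) x x) -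
        extDeriv (ζ.inChart x) (extChartAt (𝓡 n) x x) := by
    have hη' : DifferentiableAt ℝ (η.inChart x) (extChartAt (𝓡 n) x x) :=
      ContDiffAt.differentiableAt hη (by simp)
    have hζ' : DifferentiableAt ℝ (ζ.inChart x) (extChartAt (𝓡 n) x x) :=
      ContDiffAt.differentiableAt hζ (by simp)
    rw [eq_sub_iff_add_eq, ← extDeriv_add (hη'.sub hζ') hζ', sub_add_cancel]
  change (extDeriv ((η - ζ).inChart x) (extChartAt (𝓡 n) x x)).compContinuousLinearMap _ = _
  rw [inChart_sub, h]
  rfl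

/-- A function as a `0`-form. -/
def ofFun (f : M → ℝ) : DiffForm n M 0 := fun x =>
  ContinuousAlternatingMap.constOfIsEmpty ℝ (TangentSpace (𝓡 n) x) (Fin 0) (f x)

omit [IsManifold (𝓡 n) ∞ M] in
theorem ofFun_inChart (f : M → ℝ) (x : M) :
    (ofFun (n := n) f).inChart x = fun y =>
      ContinuousAlternatingMap.constOfIsEmpty ℝ (EuclideanSpace ℝ (Fin n)) (Fin 0)
        ((f ∘ (extChartAt (𝓡 n) x).symm) y) := rfl

theorem contDiffAt_comp_extChartAt_symm {f : M → ℝ} {x : M}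
    (hf : ContMDiffAt (𝓡 n) 𝓘(ℝ, ℝ) ∞ f x) :
    ContDiffAt ℝ ∞ (f ∘ (extChartAt (𝓡 n) x).symm) (extChartAt (𝓡 n) x x) := by
  have hφ : ContMDiffAt 𝓘(ℝ, EuclideanSpace ℝ (Fin n)) (𝓡 n) ∞ (extChartAt (𝓡 n) x).symm
      (extChartAt (𝓡 n) x x) :=
    (contMDiffOn_extChartAt_symm (n := ∞) x).contMDiffAt
      ((isOpen_extChartAt_target x).mem_nhds (mem_extChartAt_target x))
  exact (ContMDiffAt.comp_of_eq hf hφ (extChartAt_to_inv x)).contDiffAt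

theorem isSmoothAt_ofFun {f : M → ℝ} {x : M} (hf : ContMDiffAt (𝓡 n) 𝓘(ℝ, ℝ) ∞ f x) :
    (ofFun (n := n) f).IsSmoothAt x := by
  unfold IsSmoothAt
  rw [ofFun_inChart]
  exact (ContinuousAlternatingMap.constOfIsEmptyLIE ℝ (EuclideanSpace ℝ (Fin n)) ℝ
    (Fin 0)).contDiff.contDiffAt.comp _ (contDiffAt_comp_extChartAt_symm hf)

theorem d_ofFun {f : M → ℝ} {x : M} (hf : ContMDiffAt (𝓡 n) 𝓘(ℝ, ℝ) ∞ f x)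
    (v : Fin 1 → TangentSpace (𝓡 n) x) :
    (ofFun (n := n) f).d x v = mfderiv (𝓡 n) 𝓘(ℝ, ℝ) f x (v 0) := by
  have h1 := (contDiffAt_comp_extChartAt_symm hf).differentiableAt (by simp)
  have hφ : MDifferentiableAt (𝓡 n) 𝓘(ℝ, EuclideanSpace ℝ (Fin n)) (extChartAt (𝓡 n) x) x :=
    (contMDiffAt_extChartAt (n := ∞)).mdifferentiableAt (by simp)
  have key : mfderiv (𝓡 n) 𝓘(ℝ, ℝ) f x =
      mfderiv 𝓘(ℝ, EuclideanSpace ℝ (Fin n)) 𝓘(ℝ, ℝ) (f ∘ (extChartAt (𝓡 n) x).symm)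
        (extChartAt (𝓡 n) x x) ∘L
      mfderiv (𝓡 n) 𝓘(ℝ, EuclideanSpace ℝ (Fin n)) (extChartAt (𝓡 n) x) x := by
    refine Eq.trans ?_ (mfderiv_comp x h1.mdifferentiableAt hφ)
    apply Filter.EventuallyEq.mfderiv_eq
    filter_upwards [(isOpen_extChartAt_source (I := 𝓡 n) x).mem_nhds (mem_extChartAt_source x)]
      with z hz
    simp only [Function.comp_apply, (extChartAt (𝓡 n) x).left_inv hz]
  rw [key]
  change (extDeriv ((ofFun f).inChart x) (extChartAt (𝓡 n) x x)) _ = _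
  rw [ofFun_inChart, extDeriv_constOfIsEmpty, ← mfderiv_eq_fderiv]
  rfl

theorem isSmoothAt_d_ofFun {f : M → ℝ} (hf : ContMDiff (𝓡 n) 𝓘(ℝ, ℝ) ∞ f) (x : M) :
    (ofFun (n := n) f).d.IsSmoothAt x := by
  refine ContDiffAt.congr_of_eventuallyEq ?_
    (d_inChart_eventuallyEq (fun z => isSmoothAt_ofFun hf.contMDiffAt) x)
  rw [ofFun_inChart]
  have e : extDeriv (fun y => ContinuousAlternatingMap.constOfIsEmpty ℝ (EuclideanSpace ℝ (Fin n))
      (Fin 0) ((f ∘ (extChartAt (𝓡 n) x).symm) y)) = fun y =>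
      ContinuousAlternatingMap.ofSubsingletonLIE (𝕜 := ℝ) (E := EuclideanSpace ℝ (Fin n)) (F := ℝ)
        (0 : Fin 1) (fderiv ℝ (f ∘ (extChartAt (𝓡 n) x).symm) y) :=
    funext fun y => extDeriv_constOfIsEmpty _ y
  rw [e]
  exact (ContinuousAlternatingMap.ofSubsingletonLIE (𝕜 := ℝ) (E := EuclideanSpace ℝ (Fin n))
    (F := ℝ) (0 : Fin 1)).contDiff.contDiffAt.comp _
    ((contDiffAt_comp_extChartAt_symm hf.contMDiffAt).fderiv_right (m := ∞) (by simp))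

end DiffForm
end FormCalculus

/-! ### Gluing local primitives by monodromy -/

section Gluing

/-- On a simply connected, locally path connected space, local functions whose differences are
locally constant are, up to local constants, the restrictions of a global function. -/
theorem exists_global_of_locally_const_sub {X : Type*} [TopologicalSpace X]
    [SimplyConnectedSpace X] [LocallyPathConnectedSpace X]
    (U : X → Set X) (hU : ∀ i, IsOpen (U i)) (hmem : ∀ x, x ∈ U x) (F : X → X → ℝ)
    (hF : ∀ i j, ∀ y ∈ U i ∩ U j, ∀ᶠ z in 𝓝 y, F i z - F j z = F i y - F j y) :
    ∃ f : X → ℝ, ∀ i, ∀ y ∈ U i, ∀ᶠ z in 𝓝 y, f z - F i z = f y - F i y := by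
  -- With discrete fibres the bundle of local solutions is a covering, and its continuous sections
  -- are locally constant in each trivialization.
  let _ : TopologicalSpace ℝ := ⊥
  have _ : DiscreteTopology ℝ := ⟨rfl⟩
  let Z : FiberBundleCore X X ℝ :=
    { baseSet := U
      isOpen_baseSet := hU
      indexAt := id
      mem_baseSet_at := hmem
      -- The coordinate `t` over `U i` encodes the value `t + F i x`, which must not depend on `i`.
      coordChange := fun i j x t => t + (F i x - F j x)
      coordChange_self := by intros; simp
      continuousOn_coordChange := by
        rintro i j ⟨y, t⟩ ⟨hy, -⟩
        apply ContinuousAt.continuousWithinAt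
        have h1 : ∀ᶠ q : X × ℝ in 𝓝 (y, t), q.2 + (F i q.1 - F j q.1) = t + (F i y - F j y) := by
          have ha : ∀ᶠ q : X × ℝ in 𝓝 (y, t), F i q.1 - F j q.1 = F i y - F j y :=
            (continuous_fst.tendsto (y, t)).eventually (hF i j y hy)
          have hb : ∀ᶠ q : X × ℝ in 𝓝 (y, t), q.2 = t :=
            (continuous_snd.tendsto (y, t)).eventually (p := fun q => q = t) (by rw [nhds_discrete]; exact Filter.eventually_pure.2 rfl)
          filter_upwards [ha, hb] with q h1 h2
          rw [h1, h2]
        exact (continuousAt_const (y := t + (F i y - F j y))).congr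
          (h1.mono fun q hq => hq.symm)
      coordChange_comp := by intros; ring }
  have hcov : IsCoveringMap (Bundle.TotalSpace.proj : Z.TotalSpace → X) :=
    IsFiberBundle.isCoveringMap fun x => ⟨Z.localTriv x, hmem x⟩
  obtain ⟨x₀⟩ : Nonempty X := inferInstance
  obtain ⟨s, ⟨-, hs⟩, -⟩ := hcov.existsUnique_continuousMap_lifts (ContinuousMap.id X) x₀
    (⟨x₀, (0 : ℝ)⟩ : Z.TotalSpace) rfl
  have hproj : ∀ x, (s x).proj = x := fun x => congrFun hs x
  let val : Z.TotalSpace → ℝ := fun q => q.2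
  let f : X → ℝ := fun x => val (s x) + F (s x).proj x
  refine ⟨f, fun i y hy => ?_⟩
  have hsrc : s y ∈ (Z.localTriv i).source := by
    rw [Bundle.Trivialization.mem_source]
    change (s y).proj ∈ U i
    rw [hproj]; exact hy
  have hc : ContinuousAt (fun z => ((Z.localTriv i) (s z)).2) y :=
    continuousAt_snd.comp
      (((Z.localTriv i).continuousAt hsrc).comp s.continuous.continuousAt)
  have h2 : ∀ z, ((Z.localTriv i) (s z)).2 = f z - F i z := fun z => by
    change val (s z) + (F (s z).proj (s z).proj - F i (s z).proj) = _
    simp only [f, hproj]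
    ring
  have h3 : ∀ᶠ t in 𝓝 ((Z.localTriv i) (s y)).2, t = ((Z.localTriv i) (s y)).2 := by
    rw [nhds_discrete]; exact Filter.eventually_pure.2 rfl
  filter_upwards [hc.eventually h3] with z hz
  rw [← h2, ← h2, hz]

end Gluing

/-! ### Poincaré lemma on simply connected manifolds -/

section Primitive

variable {n : ℕ}
  {N : Type*} [TopologicalSpace N] [ChartedSpace (EuclideanSpace ℝ (Fin n)) N]
  [IsManifold (𝓡 n) ∞ N]

theorem eventually_eq_of_mfderiv_eventually_eq_zero {f : N → ℝ} {x : N}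
    (hf : ∀ᶠ z in 𝓝 x, HasMFDerivAt (𝓡 n) 𝓘(ℝ, ℝ) f z 0) : ∀ᶠ z in 𝓝 x, f z = f x := by
  have hφ : Filter.Tendsto (extChartAt (𝓡 n) x).symm (𝓝 (extChartAt (𝓡 n) x x)) (𝓝 x) := by
    have := continuousAt_extChartAt_symm (I := 𝓡 n) x
    rwa [ContinuousAt, extChartAt_to_inv] at this
  have h1 : ∀ᶠ y in 𝓝 (extChartAt (𝓡 n) x x),
      HasFDerivAt (f ∘ (extChartAt (𝓡 n) x).symm)
        (0 : EuclideanSpace ℝ (Fin n) →L[ℝ] ℝ) y := by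
    filter_upwards [hφ.eventually hf, (isOpen_extChartAt_target x).mem_nhds
      (mem_extChartAt_target (I := 𝓡 n) x)] with y hy hy'
    have hm : MDifferentiableAt 𝓘(ℝ, EuclideanSpace ℝ (Fin n)) (𝓡 n) (extChartAt (𝓡 n) x).symm y :=
      ((contMDiffOn_extChartAt_symm (n := ∞) x).contMDiffAt
        ((isOpen_extChartAt_target x).mem_nhds hy')).mdifferentiableAt (by simp)
    have := (hy.comp y hm.hasMFDerivAt).hasFDerivAt
    rwa [ContinuousLinearMap.zero_comp] at this
  obtain ⟨r, hr, hball⟩ := Metric.eventually_nhds_iff_ball.1 h1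
  have h2 : ∀ᶠ z in 𝓝 x, extChartAt (𝓡 n) x z ∈ Metric.ball (extChartAt (𝓡 n) x x) r :=
    (continuousAt_extChartAt x).eventually (Metric.ball_mem_nhds _ hr)
  filter_upwards [h2, (isOpen_extChartAt_source (I := 𝓡 n) x).mem_nhds
    (mem_extChartAt_source x)] with z hz hz'
  have h3 := (convex_ball (extChartAt (𝓡 n) x x) r).is_const_of_fderivWithin_eq_zero (𝕜 := ℝ)
    (f := f ∘ (extChartAt (𝓡 n) x).symm)
    (fun y hy => (hball y hy).differentiableAt.differentiableWithinAt)
    (fun y hy => by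
      rw [fderivWithin_of_isOpen Metric.isOpen_ball hy, (hball y hy).fderiv])
    hz (Metric.mem_ball_self hr)
  simpa only [Function.comp_apply, (extChartAt (𝓡 n) x).left_inv hz',
    (extChartAt (𝓡 n) x).left_inv (mem_extChartAt_source (I := 𝓡 n) x)] using h3

namespace DiffForm

/-- A `1`-form at a point as a linear functional. -/
def toCLM (η : DiffForm n N 1) (x : N) : TangentSpace (𝓡 n) x →L[ℝ] ℝ :=
  (ContinuousAlternatingMap.ofSubsingleton ℝ (TangentSpace (𝓡 n) x) ℝ (0 : Fin 1)).symm (η x)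

omit [IsManifold (𝓡 n) ∞ N] in
theorem ext_toCLM {η ζ : DiffForm n N 1} {x : N} (h : η.toCLM x = ζ.toCLM x) : η x = ζ x :=
  (ContinuousAlternatingMap.ofSubsingleton ℝ (TangentSpace (𝓡 n) x) ℝ (0 : Fin 1)).symm.injective h

/-- The local Poincaré lemma for `1`-forms. -/
theorem exists_local_primitive {η : DiffForm n N 1} (hη : η.IsSmooth) (hd : η.d = 0) (x : N) :
    ∃ U : Set N, IsOpen U ∧ x ∈ U ∧ ∃ F : N → ℝ, ∀ y ∈ U,
      ContMDiffAt (𝓡 n) 𝓘(ℝ, ℝ) ∞ F y ∧ HasMFDerivAt (𝓡 n) 𝓘(ℝ, ℝ) F y (η.toCLM y) := by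
  obtain ⟨r, hr, hball⟩ := Metric.isOpen_iff.1 (isOpen_extChartAt_target (I := 𝓡 n) x) _
    (mem_extChartAt_target (I := 𝓡 n) x)
  set B := Metric.ball (extChartAt (𝓡 n) x x) r with hB
  let J := ContinuousAlternatingMap.ofSubsingletonLIE (𝕜 := ℝ) (E := EuclideanSpace ℝ (Fin n))
    (F := ℝ) (0 : Fin 1)
  let τ : EuclideanSpace ℝ (Fin n) → EuclideanSpace ℝ (Fin n) →L[ℝ] ℝ :=
    fun y => J.symm (η.inChart x y)
  have hs : ContDiffOn ℝ ∞ (η.inChart x) B := (hη x).mono hball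
  have hτ : ContDiffOn ℝ ∞ τ B := J.symm.contDiff.comp_contDiffOn hs
  have hdiff : DifferentiableOn ℝ τ B := hτ.differentiableOn (by simp)
  -- For a `1`-form on a vector space, closedness is symmetry of the derivative of its coefficient
  -- map.
  have hsymm : ∀ a ∈ B, ∀ u w, fderiv ℝ τ a u w = fderiv ℝ τ a w u := by
    intro a ha u w
    have h0 : extDeriv (η.inChart x) a = 0 := by
      rw [extDeriv_inChart (hball ha) (hη.isSmoothAt _), hd]
      rfl
    have hda : DifferentiableAt ℝ (η.inChart x) a :=
      (hs.differentiableOn (by simp)).differentiableAt (Metric.isOpen_ball.mem_nhds ha)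
    have hta : DifferentiableAt ℝ τ a := hdiff.differentiableAt (Metric.isOpen_ball.mem_nhds ha)
    have h1 := extDeriv_apply hda ![u, w]
    rw [h0] at h1
    have h2 : ∀ (q : Fin 1 → EuclideanSpace ℝ (Fin n)) (e : EuclideanSpace ℝ (Fin n)),
        fderiv ℝ (fun y => η.inChart x y q) a e = fderiv ℝ τ a e (q 0) := by
      intro q e
      have : (fun y => η.inChart x y q) = fun y => τ y (q 0) := by
        funext y
        have hq : q = fun _ => q 0 := funext fun i => by rw [Subsingleton.elim i 0]
        conv_lhs => rw [hq]
        rfl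
      rw [this, fderiv_clm_apply hta (differentiableAt_const _)]
      simp
    rw [Fin.sum_univ_two, h2, h2] at h1
    simp [Fin.removeNth] at h1
    linarith
  obtain ⟨G, hG⟩ := (convex_ball (extChartAt (𝓡 n) x x) r).exists_forall_hasFDerivAt_of_fderiv_symmetric
    Metric.isOpen_ball hdiff hsymm
  have hGs : ContDiffOn ℝ ∞ G B := by
    rw [contDiffOn_infty_iff_fderiv_of_isOpen Metric.isOpen_ball]
    exact ⟨fun a ha => (hG a ha).differentiableAt.differentiableWithinAt,
      hτ.congr fun a ha => (hG a ha).fderiv⟩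
  refine ⟨(extChartAt (𝓡 n) x).source ∩ extChartAt (𝓡 n) x ⁻¹' B,
    (continuousOn_extChartAt x).isOpen_inter_preimage (isOpen_extChartAt_source x)
      Metric.isOpen_ball,
    ⟨mem_extChartAt_source x, Metric.mem_ball_self hr⟩, G ∘ extChartAt (𝓡 n) x, ?_⟩
  rintro y ⟨hy, hyB⟩
  have hφ : ContMDiffAt (𝓡 n) 𝓘(ℝ, EuclideanSpace ℝ (Fin n)) ∞ (extChartAt (𝓡 n) x) y :=
    contMDiffAt_extChartAt' (n := ∞) (by simpa using hy)
  have hφd := hφ.mdifferentiableAt (by simp)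
  refine ⟨(hGs.contDiffAt (Metric.isOpen_ball.mem_nhds hyB)).contMDiffAt.comp y hφ, ?_⟩
  have hψd : MDifferentiableAt 𝓘(ℝ, EuclideanSpace ℝ (Fin n)) (𝓡 n) (extChartAt (𝓡 n) x).symm
      (extChartAt (𝓡 n) x y) :=
    ((contMDiffOn_extChartAt_symm (n := ∞) x).contMDiffAt
      ((isOpen_extChartAt_target x).mem_nhds (hball hyB))).mdifferentiableAt (by simp)
  have h3 := (hG _ hyB).hasMFDerivAt.comp y hφd.hasMFDerivAt
  have hid : mfderiv 𝓘(ℝ, EuclideanSpace ℝ (Fin n)) (𝓡 n) (extChartAt (𝓡 n) x).symm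
        (extChartAt (𝓡 n) x y) ∘L
      mfderiv (𝓡 n) 𝓘(ℝ, EuclideanSpace ℝ (Fin n)) (extChartAt (𝓡 n) x) y =
      ContinuousLinearMap.id ℝ (EuclideanSpace ℝ (Fin n)) := by
    have hev : (extChartAt (𝓡 n) x).symm ∘ extChartAt (𝓡 n) x =ᶠ[𝓝 y] id := by
      filter_upwards [(isOpen_extChartAt_source (I := 𝓡 n) x).mem_nhds hy] with z hz
      exact (extChartAt (𝓡 n) x).left_inv hz
    exact (mfderiv_comp y hψd hφd).symm.trans (hev.mfderiv_eq.trans mfderiv_id)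
  have h4 := comp_congr η ((extChartAt (𝓡 n) x).left_inv hy) _ _ hid
  refine h3.congr_mfderiv (ContinuousLinearMap.ext fun v => ?_)
  exact DFunLike.congr_fun h4 (fun _ => v)

/-- A closed `1`-form on a simply connected manifold has a primitive. -/
theorem exists_primitive [SimplyConnectedSpace N] {η : DiffForm n N 1} (hη : η.IsSmooth)
    (hd : η.d = 0) : ∃ f : N → ℝ, ContMDiff (𝓡 n) 𝓘(ℝ, ℝ) ∞ f ∧
      ∀ x, HasMFDerivAt (𝓡 n) 𝓘(ℝ, ℝ) f x (η.toCLM x) := by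
  have : LocallyPathConnectedSpace N :=
    ChartedSpace.locallyPathConnectedSpace (EuclideanSpace ℝ (Fin n)) N
  choose U hUo hxU F hF using exists_local_primitive hη hd
  obtain ⟨f, hf⟩ := exists_global_of_locally_const_sub U hUo hxU F fun i j y hy => by
    refine eventually_eq_of_mfderiv_eventually_eq_zero (n := n) (f := fun z => F i z - F j z) ?_
    filter_upwards [((hUo i).inter (hUo j)).mem_nhds hy] with z hz
    have := (hF i z hz.1).2.sub (hF j z hz.2).2
    rwa [sub_self] at this
  have hloc : ∀ x, f =ᶠ[𝓝 x] fun z => F x z + (f x - F x x) := fun x => by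
    filter_upwards [hf x x (hxU x)] with z hz
    linarith
  refine ⟨f, fun x => ?_, fun x => ?_⟩
  · exact ((hF x x (hxU x)).1.add contMDiffAt_const).congr_of_eventuallyEq (hloc x)
  · have h1 := (hF x x (hxU x)).2.add (hasMFDerivAt_const (I := 𝓡 n) (f x - F x x) x)
    exact (h1.congr_mfderiv (add_zero _)).congr_of_eventuallyEq (hloc x)

end DiffForm

end Primitive

/-! ### Smooth curves and their concatenation -/

section Curves

variable {n : ℕ}
  {M : Type*} [TopologicalSpace M] [ChartedSpace (EuclideanSpace ℝ (Fin n)) M]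
  [IsManifold (𝓡 n) ∞ M]
  {N : Type*} [TopologicalSpace N] [ChartedSpace (EuclideanSpace ℝ (Fin n)) N]
  [IsManifold (𝓡 n) ∞ N]

theorem continuous_velocity {γ : ℝ → M} (hγ : ContMDiff 𝓘(ℝ, ℝ) (𝓡 n) ∞ γ) :
    Continuous fun t => (⟨γ t, velocity n γ t⟩ : TangentBundle (𝓡 n) M) := by
  have h1 := hγ.continuous_tangentMap (by simp)
  have h2 : Continuous fun t : ℝ => (⟨t, (1 : ℝ)⟩ : TangentBundle 𝓘(ℝ, ℝ) ℝ) := by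
    have h3 : Continuous fun t : ℝ => (tangentBundleModelSpaceHomeomorph 𝓘(ℝ, ℝ)).symm (t, (1 : ℝ)) :=
      (tangentBundleModelSpaceHomeomorph 𝓘(ℝ, ℝ)).symm.continuous.comp (by fun_prop)
    exact h3
  exact h1.comp h2

theorem continuous_kinetic (g : RiemMetric n M) {γ : ℝ → M}
    (hγ : ContMDiff 𝓘(ℝ, ℝ) (𝓡 n) ∞ γ) :
    Continuous fun t => g.inner (γ t) (velocity n γ t) (velocity n γ t) := by
  have hv := continuous_velocity hγ
  rw [continuous_iff_continuousAt] at hv ⊢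
  intro t
  have h1 : ContinuousAt (fun s => Bundle.TotalSpace.mk' ℝ (E := Bundle.Trivial M ℝ) (γ s)
      (g.inner (γ s) (velocity n γ s) (velocity n γ s))) t :=
    (g.contMDiff.continuous.continuousAt.comp (f := γ)
      hγ.continuous.continuousAt).clm_bundle_apply₂ (F₁ := EuclideanSpace ℝ (Fin n))
        (F₂ := EuclideanSpace ℝ (Fin n)) (hv t) (hv t)
  rw [FiberBundle.continuousAt_totalSpace] at h1
  exact h1.2

theorem DiffForm.IsSmooth.continuous_apply_velocity {θ : DiffForm n N 1} (hθ : θ.IsSmooth)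
    {γ : ℝ → N} (hγ : ContMDiff 𝓘(ℝ, ℝ) (𝓡 n) ∞ γ) :
    Continuous fun t => θ (γ t) (fun _ => velocity n γ t) := by
  rw [continuous_iff_continuousAt]
  intro t₀
  set x := γ t₀ with hx
  let c : ℝ → EuclideanSpace ℝ (Fin n) := extChartAt (𝓡 n) x ∘ γ
  have hsrc : ∀ᶠ t in 𝓝 t₀, γ t ∈ (extChartAt (𝓡 n) x).source :=
    hγ.continuous.continuousAt.eventually
      ((isOpen_extChartAt_source (I := 𝓡 n) x).mem_nhds (mem_extChartAt_source x))
  have hcs : ContDiffAt ℝ ∞ c t₀ :=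
    ((contMDiffAt_extChartAt (I := 𝓡 n) (n := ∞) (x := x)).comp t₀ hγ.contMDiffAt).contDiffAt
  have hev : (fun t => θ (γ t) (fun _ => velocity n γ t)) =ᶠ[𝓝 t₀]
      fun t => (ContinuousAlternatingMap.ofSubsingletonLIE (𝕜 := ℝ)
        (E := EuclideanSpace ℝ (Fin n)) (F := ℝ) (0 : Fin 1)).symm (θ.inChart x (c t))
          (fderiv ℝ c t 1) := by
    filter_upwards [hsrc] with t ht
    have hψd : MDifferentiableAt 𝓘(ℝ, EuclideanSpace ℝ (Fin n)) (𝓡 n) (extChartAt (𝓡 n) x).symm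
        (c t) := ((contMDiffOn_extChartAt_symm (n := ∞) x).contMDiffAt
        ((isOpen_extChartAt_target x).mem_nhds
          ((extChartAt (𝓡 n) x).map_source ht))).mdifferentiableAt (by simp)
    have hcd : MDifferentiableAt 𝓘(ℝ, ℝ) 𝓘(ℝ, EuclideanSpace ℝ (Fin n)) c t :=
      ((contMDiffAt_extChartAt' (n := ∞) (by simpa using ht)).comp t
        hγ.contMDiffAt).mdifferentiableAt (by simp)
    have hev' : (extChartAt (𝓡 n) x).symm ∘ c =ᶠ[𝓝 t] γ := by
      filter_upwards [hγ.continuous.continuousAt.eventually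
        ((isOpen_extChartAt_source (I := 𝓡 n) x).mem_nhds ht)] with s hs
      exact (extChartAt (𝓡 n) x).left_inv hs
    have hvel : mfderiv 𝓘(ℝ, EuclideanSpace ℝ (Fin n)) (𝓡 n) (extChartAt (𝓡 n) x).symm (c t)
        (fderiv ℝ c t 1) = velocity n γ t := by
      have h1 := (mfderiv_comp t hψd hcd).symm.trans hev'.mfderiv_eq
      rw [← mfderiv_eq_fderiv]
      exact DFunLike.congr_fun h1 (1 : ℝ)
    have h2 := DiffForm.comp_congr θ ((extChartAt (𝓡 n) x).left_inv ht)
      (ContinuousLinearMap.id ℝ _) _ rfl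
    have h3 := DFunLike.congr_fun h2 (fun _ => velocity n γ t)
    refine Eq.trans ?_ h3.symm |>.trans ?_
    · rfl
    · rw [← hvel]; rfl
  refine ContinuousAt.congr ?_ hev.symm
  have hα : ContinuousAt (θ.inChart x) (c t₀) :=
    (hθ.isSmoothAt x).continuousAt
  exact ((ContinuousAlternatingMap.ofSubsingletonLIE (𝕜 := ℝ)
    (E := EuclideanSpace ℝ (Fin n)) (F := ℝ) (0 : Fin 1)).symm.continuous.continuousAt.comp
      (hα.comp hcs.continuousAt)).clm_apply
    ((hcs.continuousAt_fderiv (by simp)).clm_apply continuousAt_const)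

theorem ContMDiff.isAbsContCurve {γ : ℝ → N} (hγ : ContMDiff 𝓘(ℝ, ℝ) (𝓡 n) ∞ γ) (T : ℝ) :
    IsAbsContCurve n γ T := by
  refine ⟨hγ.continuous.continuousOn, fun x₀ a b _ hab _ hmaps => ?_⟩
  apply ContDiffOn.absolutelyContinuousOnInterval
  rw [Set.uIcc_of_le hab]
  intro t ht
  have h1 : ContMDiffAt 𝓘(ℝ, ℝ) 𝓘(ℝ, EuclideanSpace ℝ (Fin n)) ∞ (extChartAt (𝓡 n) x₀ ∘ γ) t :=
    (contMDiffAt_extChartAt' (n := ∞) (by simpa using hmaps ht)).comp t hγ.contMDiffAt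
  exact (h1.contDiffAt.of_le (by simp)).contDiffWithinAt

omit [IsManifold (𝓡 n) ∞ M] [IsManifold (𝓡 n) ∞ N] in
theorem velocity_comp {f : N → M} {γ : ℝ → N} {t : ℝ}
    (hf : MDifferentiableAt (𝓡 n) (𝓡 n) f (γ t))
    (hγ : MDifferentiableAt 𝓘(ℝ, ℝ) (𝓡 n) γ t) :
    velocity n (f ∘ γ) t = mfderiv (𝓡 n) (𝓡 n) f (γ t) (velocity n γ t) :=
  DFunLike.congr_fun (mfderiv_comp t hf hγ) (1 : ℝ)

variable (n) in
/-- `γ` is a smooth curve from `x` to `y` in time `T`, constant near both ends. -/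
structure IsConnectingCurve (γ : ℝ → N) (x y : N) (T : ℝ) : Prop where
  smooth : ContMDiff 𝓘(ℝ, ℝ) (𝓡 n) ∞ γ
  two_le : 2 ≤ T
  left : ∀ t ≤ 1, γ t = x
  right : ∀ t, T - 1 ≤ t → γ t = y

/-- The concatenation of two curves at time `T`. -/
def concatCurve (γ γ' : ℝ → N) (T : ℝ) : ℝ → N := fun t => if t ≤ T then γ t else γ' (t - T)

namespace IsConnectingCurve

variable {γ γ' : ℝ → N} {x y z : N} {T T' : ℝ}

omit [IsManifold (𝓡 n) ∞ N] in
theorem concatCurve_eq_left (h : IsConnectingCurve n γ x y T) (h' : IsConnectingCurve n γ' y z T')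
    {t : ℝ} (ht : t < T + 1) : concatCurve γ γ' T t = γ t := by
  unfold concatCurve
  split_ifs with htT
  · rfl
  · rw [h'.left _ (by linarith), h.right _ (by linarith)]

omit [IsManifold (𝓡 n) ∞ N] in
theorem concatCurve_eq_right (h : IsConnectingCurve n γ x y T)
    (h' : IsConnectingCurve n γ' y z T') {t : ℝ} (ht : T - 1 < t) :
    concatCurve γ γ' T t = γ' (t - T) := by
  unfold concatCurve
  split_ifs with htT
  · rw [h'.left _ (by linarith), h.right _ (by linarith)]
  · rfl

omit [IsManifold (𝓡 n) ∞ N] in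
theorem concat_eventuallyEq_left (h : IsConnectingCurve n γ x y T)
    (h' : IsConnectingCurve n γ' y z T') {t : ℝ} (ht : t < T + 1) :
    concatCurve γ γ' T =ᶠ[𝓝 t] γ := by
  filter_upwards [Iio_mem_nhds ht] with s hs using h.concatCurve_eq_left h' hs

omit [IsManifold (𝓡 n) ∞ N] in
theorem concat_eventuallyEq_right (h : IsConnectingCurve n γ x y T)
    (h' : IsConnectingCurve n γ' y z T') {t : ℝ} (ht : T - 1 < t) :
    concatCurve γ γ' T =ᶠ[𝓝 t] fun s => γ' (s - T) := by
  filter_upwards [Ioi_mem_nhds ht] with s hs using h.concatCurve_eq_right h' hs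

-- Both curves are constant near the junction, so around each time the concatenation coincides with
-- one of the smooth pieces.
omit [IsManifold (𝓡 n) ∞ N] in
theorem concat (h : IsConnectingCurve n γ x y T) (h' : IsConnectingCurve n γ' y z T') :
    IsConnectingCurve n (concatCurve γ γ' T) x z (T + T') where
  smooth t := by
    rcases lt_or_ge t (T + 1) with ht | ht
    · exact h.smooth.contMDiffAt.congr_of_eventuallyEq (h.concat_eventuallyEq_left h' ht)
    · refine ContMDiffAt.congr_of_eventuallyEq ?_ (h.concat_eventuallyEq_right h' (t := t)
        (by linarith))
      have : ContMDiff 𝓘(ℝ, ℝ) 𝓘(ℝ, ℝ) ∞ fun s : ℝ => s - T :=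
        (contDiff_id.sub contDiff_const).contMDiff
      exact (h'.smooth.comp this).contMDiffAt
  two_le := by linarith [h.two_le, h'.two_le]
  left t ht := by
    rw [h.concatCurve_eq_left h' (by linarith [h.two_le]), h.left t ht]
  right t ht := by
    rw [h.concatCurve_eq_right h' (by linarith [h'.two_le]), h'.right _ (by linarith)]

omit [IsManifold (𝓡 n) ∞ M] [IsManifold (𝓡 n) ∞ N] in
theorem comp (h : IsConnectingCurve n γ x y T) {f : N → M} (hf : ContMDiff (𝓡 n) (𝓡 n) ∞ f) :
    IsConnectingCurve n (f ∘ γ) (f x) (f y) T where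
  smooth := hf.comp h.smooth
  two_le := h.two_le
  left t ht := congrArg f (h.left t ht)
  right t ht := congrArg f (h.right t ht)

theorem exists_eventually (x : N) : ∀ᶠ z in 𝓝 x,
    (∃ γ T, IsConnectingCurve n γ x z T) ∧ ∃ γ T, IsConnectingCurve n γ z x T := by
  obtain ⟨r, hr, hball⟩ := Metric.isOpen_iff.1 (isOpen_extChartAt_target (I := 𝓡 n) x) _
    (mem_extChartAt_target (I := 𝓡 n) x)
  have key : ∀ z z' : N, z ∈ (extChartAt (𝓡 n) x).source → z' ∈ (extChartAt (𝓡 n) x).source →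
      extChartAt (𝓡 n) x z ∈ Metric.ball (extChartAt (𝓡 n) x x) r →
      extChartAt (𝓡 n) x z' ∈ Metric.ball (extChartAt (𝓡 n) x x) r →
      ∃ γ T, IsConnectingCurve n γ z z' T := by
    intro z z' hz hz' hzb hzb'
    -- A segment in the chart, run through during `[1, 2]`; with total time `3` it rests for a unit
    -- of time at each end.
    let c : ℝ → EuclideanSpace ℝ (Fin n) := fun t => extChartAt (𝓡 n) x z +
      Real.smoothTransition (t - 1) • (extChartAt (𝓡 n) x z' - extChartAt (𝓡 n) x z)
    have hc : ContDiff ℝ ∞ c :=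
      contDiff_const.add ((Real.smoothTransition.contDiff.comp
        (contDiff_id.sub contDiff_const)).smul contDiff_const)
    have hcb : ∀ t, c t ∈ (extChartAt (𝓡 n) x).target := fun t =>
      hball ((convex_ball _ _).add_smul_sub_mem hzb hzb'
        ⟨Real.smoothTransition.nonneg _, Real.smoothTransition.le_one _⟩)
    refine ⟨fun t => (extChartAt (𝓡 n) x).symm (c t), 3, fun t => ?_, by norm_num,
      fun t ht => ?_, fun t ht => ?_⟩
    · exact ((contMDiffOn_extChartAt_symm (n := ∞) x).contMDiffAt
        ((isOpen_extChartAt_target x).mem_nhds (hcb t))).comp t hc.contMDiff.contMDiffAt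
    · simp only [c, Real.smoothTransition.zero_of_nonpos (show t - 1 ≤ 0 by linarith), zero_smul,
        add_zero, (extChartAt (𝓡 n) x).left_inv hz]
    · simp only [c, Real.smoothTransition.one_of_one_le (show 1 ≤ t - 1 by linarith), one_smul,
        add_sub_cancel, (extChartAt (𝓡 n) x).left_inv hz']
  have h2 : ∀ᶠ z in 𝓝 x, extChartAt (𝓡 n) x z ∈ Metric.ball (extChartAt (𝓡 n) x x) r :=
    (continuousAt_extChartAt x).eventually (Metric.ball_mem_nhds _ hr)
  filter_upwards [h2, (isOpen_extChartAt_source (I := 𝓡 n) x).mem_nhds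
    (mem_extChartAt_source x)] with z hz hz'
  exact ⟨key x z (mem_extChartAt_source x) hz' (Metric.mem_ball_self hr) hz,
    key z x hz' (mem_extChartAt_source x) hz (Metric.mem_ball_self hr)⟩

variable (n) in
theorem exists_of_preconnectedSpace [PreconnectedSpace N] (x y : N) :
    ∃ γ T, IsConnectingCurve n γ x y T :=
  PreconnectedSpace.induction₂' (fun x y : N => ∃ γ T, IsConnectingCurve n γ x y T)
    exists_eventually ⟨fun _ _ _ ⟨_, _, h⟩ ⟨_, _, h'⟩ => ⟨_, _, h.concat h'⟩⟩ x y

end IsConnectingCurve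

end Curves

/-! ### The action and its minimal potential -/

section Action

variable {n : ℕ}
  {M : Type*} [TopologicalSpace M] [ChartedSpace (EuclideanSpace ℝ (Fin n)) M]
  [IsManifold (𝓡 n) ∞ M]
  {N : Type*} [TopologicalSpace N] [ChartedSpace (EuclideanSpace ℝ (Fin n)) N]
  [IsManifold (𝓡 n) ∞ N]
  {g : RiemMetric n M} {p : N → M} {θ : DiffForm n N 1} {k : ℝ}

variable (g p θ k) in
/-- The integrand of the action along a curve. -/
def lagrangianAlong (γ : ℝ → N) (t : ℝ) : ℝ :=
  magneticLagrangian g p θ (γ t) (velocity n γ t) + k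

variable (g p θ k) in
/-- The action of a curve, as a real number. -/
def curveAction (γ : ℝ → N) (T : ℝ) : ℝ := ∫ t in (0 : ℝ)..T, lagrangianAlong g p θ k γ t

-- The kinetic term depends only on the projected curve `p ∘ γ`, which makes its deck invariance
-- evident.
omit [IsManifold (𝓡 n) ∞ N] in
theorem lagrangianAlong_eq (hp : ContMDiff (𝓡 n) (𝓡 n) ∞ p) {γ : ℝ → N}
    (hγ : ContMDiff 𝓘(ℝ, ℝ) (𝓡 n) ∞ γ) (t : ℝ) :
    lagrangianAlong g p θ k γ t = (1 / 2) * g.inner ((p ∘ γ) t) (velocity n (p ∘ γ) t)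
      (velocity n (p ∘ γ) t) - θ (γ t) (fun _ => velocity n γ t) + k := by
  rw [velocity_comp (hp.mdifferentiable (by simp) _) (hγ.mdifferentiable (by simp) _)]
  rfl

theorem continuous_lagrangianAlong (hp : ContMDiff (𝓡 n) (𝓡 n) ∞ p) (hθ : θ.IsSmooth)
    {γ : ℝ → N} (hγ : ContMDiff 𝓘(ℝ, ℝ) (𝓡 n) ∞ γ) : Continuous (lagrangianAlong g p θ k γ) := by
  have h : lagrangianAlong g p θ k γ = fun t => (1 / 2) * g.inner ((p ∘ γ) t)
      (velocity n (p ∘ γ) t) (velocity n (p ∘ γ) t) - θ (γ t) (fun _ => velocity n γ t) + k :=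
    funext fun t => lagrangianAlong_eq hp hγ t
  rw [h]
  exact ((continuous_const.mul (continuous_kinetic g (hp.comp hγ))).sub
    (hθ.continuous_apply_velocity hγ)).add continuous_const

theorem magneticAction_eq (hp : ContMDiff (𝓡 n) (𝓡 n) ∞ p) (hθ : θ.IsSmooth)
    {γ : ℝ → N} (hγ : ContMDiff 𝓘(ℝ, ℝ) (𝓡 n) ∞ γ) {T : ℝ} (hT : 0 ≤ T) :
    magneticAction g p θ k γ T = (curveAction g p θ k γ T : EReal) := by
  unfold magneticAction
  have hc : Continuous fun t => magneticLagrangian g p θ (γ t) (velocity n γ t) + k :=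
    continuous_lagrangianAlong (g := g) (k := k) hp hθ hγ
  rw [if_pos (hc.continuousOn.integrableOn_Icc), MeasureTheory.integral_Icc_eq_integral_Ioc,
    ← intervalIntegral.integral_of_le hT]
  rfl

omit [IsManifold (𝓡 n) ∞ N] in
theorem lagrangianAlong_congr {γ γ' : ℝ → N} {t : ℝ} (h : γ =ᶠ[𝓝 t] γ') :
    lagrangianAlong g p θ k γ t = lagrangianAlong g p θ k γ' t := by
  have h1 : ∀ (a b : N) (_ : a = b) (v w : EuclideanSpace ℝ (Fin n)) (_ : v = w),
      magneticLagrangian g p θ a v = magneticLagrangian g p θ b w := by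
    rintro a _ rfl v _ rfl; rfl
  have h2 := DFunLike.congr_fun (h.mfderiv_eq (I := 𝓘(ℝ, ℝ)) (I' := 𝓡 n)) (1 : ℝ)
  exact congrArg (· + k) (h1 _ _ h.eq_of_nhds _ _ h2)

omit [IsManifold (𝓡 n) ∞ N] in
theorem lagrangianAlong_comp_sub {γ : ℝ → N} (hγ : ContMDiff 𝓘(ℝ, ℝ) (𝓡 n) ∞ γ) (a t : ℝ) :
    lagrangianAlong g p θ k (fun s => γ (s - a)) t = lagrangianAlong g p θ k γ (t - a) := by
  have h1 : HasMFDerivAt 𝓘(ℝ, ℝ) 𝓘(ℝ, ℝ) (fun s : ℝ => s - a) t (ContinuousLinearMap.id ℝ ℝ) :=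
    ((hasFDerivAt_id t).sub_const a).hasMFDerivAt
  have h2 := ((hγ.mdifferentiable (by simp) (t - a)).hasMFDerivAt.comp t h1).mfderiv
  have h3 : velocity n (fun s => γ (s - a)) t = velocity n γ (t - a) :=
    DFunLike.congr_fun h2 (1 : ℝ)
  exact congrArg (fun v => magneticLagrangian g p θ (γ (t - a)) v + k) h3

theorem curveAction_concat (hp : ContMDiff (𝓡 n) (𝓡 n) ∞ p) (hθ : θ.IsSmooth)
    {γ γ' : ℝ → N} {x y z : N} {T T' : ℝ} (h : IsConnectingCurve n γ x y T)
    (h' : IsConnectingCurve n γ' y z T') :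
    curveAction g p θ k (concatCurve γ γ' T) (T + T') =
      curveAction g p θ k γ T + curveAction g p θ k γ' T' := by
  have hT := h.two_le
  have hT' := h'.two_le
  have hc := continuous_lagrangianAlong (g := g) (k := k) hp hθ (h.concat h').smooth
  unfold curveAction
  rw [← intervalIntegral.integral_add_adjacent_intervals (hc.intervalIntegrable 0 T)
    (hc.intervalIntegrable T (T + T'))]
  congr 1
  · refine intervalIntegral.integral_congr fun t ht => ?_
    rw [Set.uIcc_of_le (by linarith)] at ht
    exact lagrangianAlong_congr (h.concat_eventuallyEq_left h' (by linarith [ht.2]))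
  · have h1 : Set.EqOn (lagrangianAlong g p θ k (concatCurve γ γ' T))
        (fun t => lagrangianAlong g p θ k γ' (t - T)) (Set.uIcc T (T + T')) := by
      intro t ht
      rw [Set.uIcc_of_le (by linarith)] at ht
      exact (lagrangianAlong_congr (h.concat_eventuallyEq_right h' (by linarith [ht.1]))).trans
        (lagrangianAlong_comp_sub h'.smooth T t)
    rw [intervalIntegral.integral_congr h1,
      intervalIntegral.integral_comp_sub_right (fun t => lagrangianAlong g p θ k γ' t) T,
      sub_self, add_sub_cancel_left]

/-- Under a lift of the identity, the action changes by the boundary values of a primitive of the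
change of `θ`. -/
theorem curveAction_comp (hp : ContMDiff (𝓡 n) (𝓡 n) ∞ p) (hθ : θ.IsSmooth)
    {h : N → N} (hh : ContMDiff (𝓡 n) (𝓡 n) ∞ h) (hph : p ∘ h = p) {f : N → ℝ}
    (hf : ∀ z, HasMFDerivAt (𝓡 n) 𝓘(ℝ, ℝ) f z ((θ.pullback h - θ).toCLM z))
    {γ : ℝ → N} {x y : N} {T : ℝ} (hγ : IsConnectingCurve n γ x y T) :
    curveAction g p θ k (h ∘ γ) T = curveAction g p θ k γ T - (f y - f x) := by
  have hc := continuous_lagrangianAlong (g := g) (k := k) hp hθ hγ.smooth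
  have hc' := continuous_lagrangianAlong (g := g) (k := k) hp hθ (hh.comp hγ.smooth)
  have hT := hγ.two_le
  -- The kinetic terms and `k` cancel, and the difference of the two integrands is `h^*θ - θ = df`
  -- on the velocity.
  have hd : ∀ t, HasDerivAt (f ∘ γ)
      (lagrangianAlong g p θ k γ t - lagrangianAlong g p θ k (h ∘ γ) t) t := by
    intro t
    let D : ℝ →L[ℝ] ℝ := (θ.pullback h - θ).toCLM (γ t) ∘L mfderiv 𝓘(ℝ, ℝ) (𝓡 n) γ t
    have h1 : HasFDerivAt (f ∘ γ) D t := ((hf (γ t)).comp t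
      (hγ.smooth.mdifferentiable (by simp) t).hasMFDerivAt).hasFDerivAt
    refine h1.hasDerivAt.congr_deriv ?_
    have h2 : θ ((h ∘ γ) t) (fun _ => velocity n (h ∘ γ) t) =
        θ.pullback h (γ t) (fun _ => velocity n γ t) := by
      rw [velocity_comp (hh.mdifferentiable (by simp) _) (hγ.smooth.mdifferentiable (by simp) _)]
      rfl
    rw [lagrangianAlong_eq hp hγ.smooth, lagrangianAlong_eq hp (hh.comp hγ.smooth), h2,
      ← Function.comp_assoc, hph]
    change θ.pullback h (γ t) (fun _ => velocity n γ t) - θ (γ t) (fun _ => velocity n γ t) = _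
    ring
  have h3 := intervalIntegral.integral_eq_sub_of_hasDerivAt (a := 0) (b := T)
    (fun t _ => hd t) ((hc.sub hc').intervalIntegrable 0 T)
  rw [intervalIntegral.integral_sub (hc.intervalIntegrable 0 T) (hc'.intervalIntegrable 0 T)] at h3
  simp only [Function.comp_apply, hγ.left 0 (by norm_num), hγ.right T (by linarith)] at h3
  unfold curveAction
  linarith

/-- If the action is nonnegative on closed curves, there is a function whose change under lifts of
the identity controls the change of `θ`. -/
theorem exists_potential [PreconnectedSpace N] [Nonempty N] (hp : ContMDiff (𝓡 n) (𝓡 n) ∞ p)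
    (hθ : θ.IsSmooth)
    (hk : ∀ (T : ℝ) (γ : ℝ → N), 0 < T → IsAbsContCurve n γ T → γ 0 = γ T →
      0 ≤ magneticAction g p θ k γ T) :
    ∃ u : N → ℝ, ∀ x y, ∃ C : ℝ, ∀ (h : N → N) (f : N → ℝ), ContMDiff (𝓡 n) (𝓡 n) ∞ h →
      p ∘ h = p → (∀ z, HasMFDerivAt (𝓡 n) 𝓘(ℝ, ℝ) f z ((θ.pullback h - θ).toCLM z)) →
      |(f y + u (h y)) - (f x + u (h x))| ≤ C := by
  obtain ⟨e⟩ := ‹Nonempty N›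
  let S : N → Set ℝ := fun x => {a | ∃ γ T, IsConnectingCurve n γ e x T ∧
    curveAction g p θ k γ T = a}
  have hclosed : ∀ (γ : ℝ → N) (x : N) (T : ℝ), IsConnectingCurve n γ x x T →
      0 ≤ curveAction g p θ k γ T := fun γ x T hγ => by
    have hT := hγ.two_le
    have h1 := hk T γ (by linarith) (hγ.smooth.isAbsContCurve T)
      (by rw [hγ.left 0 (by norm_num), hγ.right T (by linarith)])
    rw [magneticAction_eq hp hθ hγ.smooth (by linarith)] at h1
    exact_mod_cast h1
  have hne : ∀ x, (S x).Nonempty := fun x => by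
    obtain ⟨γ, T, h⟩ := IsConnectingCurve.exists_of_preconnectedSpace n e x
    exact ⟨_, γ, T, h, rfl⟩
  -- A fixed return curve `σ` closes up every competitor, so `-A(σ)` is a lower bound.
  have hbdd : ∀ x, BddBelow (S x) := fun x => by
    obtain ⟨σ, T', h'⟩ := IsConnectingCurve.exists_of_preconnectedSpace n x e
    refine ⟨-curveAction g p θ k σ T', ?_⟩
    rintro _ ⟨γ, T, h, rfl⟩
    have := hclosed _ _ _ (h.concat h')
    rw [curveAction_concat hp hθ h h'] at this
    linarith
  have hu : ∀ {γ x y T}, IsConnectingCurve n γ x y T →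
      sInf (S y) ≤ sInf (S x) + curveAction g p θ k γ T := fun {γ x y T} h => by
    rw [← sub_le_iff_le_add]
    refine le_csInf (hne x) ?_
    rintro _ ⟨γ', T', h', rfl⟩
    rw [sub_le_iff_le_add, ← curveAction_concat hp hθ h' h]
    exact csInf_le (hbdd y) ⟨_, _, h'.concat h, rfl⟩
  refine ⟨fun x => sInf (S x), fun x y => ?_⟩
  obtain ⟨γ, T, hγ⟩ := IsConnectingCurve.exists_of_preconnectedSpace n x y
  obtain ⟨σ, T', hσ⟩ := IsConnectingCurve.exists_of_preconnectedSpace n y x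
  -- The curves `γ` and `σ` are chosen before `h`, so the bound is uniform in `h`; their images
  -- under `h` give the two sides of the estimate.
  refine ⟨max (curveAction g p θ k γ T) (curveAction g p θ k σ T'), fun h f hh hph hf => ?_⟩
  have h1 := hu (hγ.comp hh)
  have h2 := hu (hσ.comp hh)
  rw [curveAction_comp hp hθ hh hph hf hγ] at h1
  rw [curveAction_comp hp hθ hh hph hf hσ] at h2
  rw [abs_le']
  exact ⟨le_max_of_le_left (by linarith), le_max_of_le_right (by linarith)⟩

end Action

/-! ### Averaging over an amenable group -/

section Mean

/-- The passage to the opposite group turns left translations into right translations. Right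
invariance is the form needed, because the cocycle identity produces the argument `h * g`. -/
theorem IsAmenableGroup.exists_right_invariant_mean {Γ G : Type*} [Group Γ] [Group G]
    (hΓ : IsAmenableGroup Γ) (Φ : Γ ≃* Gᵐᵒᵖ) :
    ∃ m : boundedFunctions G →ₗ[ℝ] ℝ,
      (∀ a : boundedFunctions G, (∀ g, a.1 g = 1) → m a = 1) ∧
      ∀ (h : G) (a b : boundedFunctions G), (∀ g, b.1 g = a.1 (g * h)) → m b = m a := by
  obtain ⟨m, h1, -, hinv⟩ := hΓ
  let R : boundedFunctions G →ₗ[ℝ] boundedFunctions Γ :=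
    { toFun := fun a => ⟨fun γ => a.1 (Φ γ).unop, by
        obtain ⟨C, hC⟩ := a.2
        exact ⟨C, fun γ => hC _⟩⟩
      map_add' := fun _ _ => rfl
      map_smul' := fun _ _ => rfl }
  refine ⟨m ∘ₗ R, fun a ha => h1 _ fun γ => ha _, fun h a b hab => ?_⟩
  refine hinv (Φ.symm (MulOpposite.op h)) (R a) (R b) fun γ => ?_
  change b.1 (Φ γ).unop = a.1 (Φ (Φ.symm (MulOpposite.op h) * γ)).unop
  rw [hab, map_mul, Φ.apply_symm_apply]
  rfl

/-- Averaging a bounded family of primitives of a group cocycle over an amenable group. -/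
theorem exists_averaged_primitive {Γ G : Type*} [Group Γ] [Group G] (hΓ : IsAmenableGroup Γ)
    (Φ : Γ ≃* Gᵐᵒᵖ) {X : Type*} [MulAction G X] (e : X) (f : G → X → ℝ) (u : X → ℝ)
    (hbdd : ∀ x, ∃ C, ∀ g : G, |(f g x + u (g • x)) - (f g e + u (g • e))| ≤ C)
    (hcoc : ∀ (h g : G) (x : X), f (h * g) x - f h (g • x) - f g x =
      f (h * g) e - f h (g • e) - f g e) :
    ∃ w : X → ℝ, ∀ g : G, ∃ c : ℝ, ∀ x, w (g • x) = w x - f g x + c := by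
  obtain ⟨m, h1, hinv⟩ := hΓ.exists_right_invariant_mean Φ
  let b : X → boundedFunctions G := fun x =>
    ⟨fun g => (f g x + u (g • x)) - (f g e + u (g • e)), hbdd x⟩
  let one : boundedFunctions G := ⟨fun _ => 1, 1, fun _ => by simp⟩
  have hone : m one = 1 := h1 one fun _ => rfl
  refine ⟨fun x => m (b x), fun g => ⟨m (b (g • e)) + f g e, fun x => ?_⟩⟩
  have hb : ∃ C, ∀ h : G, |(b x).1 (h * g)| ≤ C := by
    obtain ⟨C, hC⟩ := (b x).2
    exact ⟨C, fun h => hC _⟩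
  let b' : boundedFunctions G := ⟨fun h => (b x).1 (h * g), hb⟩
  have hb' : m b' = m (b x) := hinv g (b x) b' fun _ => rfl
  -- The cocycle identity, as an equality of bounded functions of `h`: moving `x` by `g` is a right
  -- translation of `b x`, up to terms whose means are known.
  have hsum : b (g • x) = b' + b (g • e) + (f g e - f g x) • one := by
    ext h
    change (f h (g • x) + u (h • g • x)) - (f h e + u (h • e)) =
      ((f (h * g) x + u ((h * g) • x)) - (f (h * g) e + u ((h * g) • e))) +
      ((f h (g • e) + u (h • g • e)) - (f h e + u (h • e))) + (f g e - f g x) * 1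
    have := hcoc h g x
    simp only [mul_smul]
    linarith
  simp only [hsum, map_add, map_smul, hone, hb', smul_eq_mul]
  ring

end Mean

/-! ### Deck transformations of the universal covering -/

section Deck

variable {M N : Type*} [TopologicalSpace M] [TopologicalSpace N]

/-- The group of deck transformations. -/
def deckGroup (p : N → M) : Subgroup (N ≃ₜ N) where
  carrier := {h | ∀ x, p (h x) = p x}
  mul_mem' := fun {a b} ha hb x => (ha (b x)).trans (hb x)
  one_mem' := fun _ => rfl
  inv_mem' := fun {a} ha x => by
    have := ha (a⁻¹ x)
    rw [← this]
    exact congrArg p (a.apply_symm_apply x)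

instance deckGroup.instMulAction (p : N → M) : MulAction (deckGroup p) N where
  smul h x := h.1 x
  one_smul _ := rfl
  mul_smul _ _ _ := rfl

namespace deckGroup

variable {p : N → M}

omit [TopologicalSpace M] in
theorem map_smul (h : deckGroup p) (x : N) : p (h • x) = p x := h.2 x

omit [TopologicalSpace M] in
theorem continuous_smul (h : deckGroup p) : Continuous fun x : N => h • x := h.1.continuous

/-- Lifting `p` through itself in both directions, with `x ↦ y` and `y ↦ x`, gives maps that are
mutually inverse by uniqueness of lifts. -/
theorem exists_smul_eq (hp : IsCoveringMap p) [SimplyConnectedSpace N]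
    [LocallyPathConnectedSpace N] {x y : N} (h : p x = p y) : ∃ g : deckGroup p, g • x = y := by
  obtain ⟨a, ⟨hax, hap⟩, -⟩ := hp.existsUnique_continuousMap_lifts ⟨p, hp.continuous⟩ x y h.symm
  obtain ⟨b, ⟨hby, hbp⟩, -⟩ := hp.existsUnique_continuousMap_lifts ⟨p, hp.continuous⟩ y x h
  have hap' : ∀ z, p (a z) = p z := congrFun hap
  have hbp' : ∀ z, p (b z) = p z := congrFun hbp
  have hba : b ∘ a = id := hp.eq_of_comp_eq (b.continuous.comp a.continuous) continuous_id
    (funext fun z => (hbp' _).trans (hap' z)) x (by simp [hax, hby])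
  have hab : a ∘ b = id := hp.eq_of_comp_eq (a.continuous.comp b.continuous) continuous_id
    (funext fun z => (hap' _).trans (hbp' z)) y (by simp [hax, hby])
  exact ⟨⟨⟨⟨a, b, congrFun hba, congrFun hab⟩, a.continuous, b.continuous⟩, hap'⟩, hax⟩

theorem eventuallyEq_of_comp_eventuallyEq (hp : IsCoveringMap p) {X : Type*} [TopologicalSpace X]
    {a b : X → N} {x : X} (ha : ContinuousAt a x) (hb : ContinuousAt b x) (hab : a x = b x)
    (h : ∀ᶠ z in 𝓝 x, p (a z) = p (b z)) : a =ᶠ[𝓝 x] b := by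
  obtain ⟨φ, hφ, rfl⟩ := hp.isLocalHomeomorph (a x)
  filter_upwards [h, ha.preimage_mem_nhds (φ.open_source.mem_nhds hφ),
    hb.preimage_mem_nhds (φ.open_source.mem_nhds (hab ▸ hφ))] with z h1 h2 h3
  exact φ.injOn h2 h3 h1

/-- Local lifts of the same map differ by one deck transformation: match them at `x`, then use local
injectivity of `p`. -/
theorem exists_eventuallyEq_smul (hp : IsCoveringMap p) [SimplyConnectedSpace N]
    [LocallyPathConnectedSpace N] {X : Type*} [TopologicalSpace X]
    {a b : X → N} {x : X} (ha : ContinuousAt a x) (hb : ContinuousAt b x)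
    (h : ∀ᶠ z in 𝓝 x, p (a z) = p (b z)) : ∃ g : deckGroup p, b =ᶠ[𝓝 x] fun z => g • a z := by
  obtain ⟨g, hg⟩ := exists_smul_eq hp h.self_of_nhds
  refine ⟨g, eventuallyEq_of_comp_eventuallyEq hp hb
    ((continuous_smul g).continuousAt.comp ha) hg.symm ?_⟩
  filter_upwards [h] with z hz
  exact hz.symm.trans (map_smul g (a z)).symm

/-- This presents `M` as the quotient by the deck group, which identifies the fundamental group with
the opposite of the deck group. -/
theorem isQuotientCoveringMap (hp : IsCoveringMap p) (hsurj : Function.Surjective p)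
    [SimplyConnectedSpace N] [LocallyPathConnectedSpace N] :
    IsQuotientCoveringMap p (deckGroup p) where
  toIsQuotientMap := hp.isQuotientMap hsurj
  continuous_const_smul g := continuous_smul g
  apply_eq_iff_mem_orbit {x y} :=
    ⟨fun h => exists_smul_eq hp h.symm, by rintro ⟨g, rfl⟩; exact map_smul g y⟩
  disjoint x := by
    obtain ⟨φ, hφ, hpφ⟩ := hp.isLocalHomeomorph x
    refine ⟨φ.source, φ.open_source.mem_nhds hφ, ?_⟩
    rintro g ⟨_, ⟨z, hz, rfl⟩, hgz⟩
    -- On a set where `p` is injective, a translate that returns to the set fixes a point, and a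
    -- deck transformation with a fixed point is the identity.
    have h1 : g • z = z := φ.injOn hgz hz (by rw [← hpφ]; exact map_smul g z)
    have h2 : (fun x : N => g • x) = id := hp.eq_of_comp_eq (continuous_smul g) continuous_id
      (funext fun w => map_smul g w) z h1
    exact Subtype.ext (Homeomorph.ext (congrFun h2))

end deckGroup

theorem IsCoveringMap.surjective_of_pathConnected {p : N → M} (hp : IsCoveringMap p) [Nonempty N]
    [PathConnectedSpace M] : Function.Surjective p := by
  intro y
  obtain ⟨e⟩ := ‹Nonempty N›
  let γ := PathConnectedSpace.somePath (p e) y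
  refine ⟨hp.liftPath γ e γ.source 1, ?_⟩
  exact (congrFun (hp.liftPath_lifts γ e γ.source) 1).trans γ.target

end Deck

/-! ### Descent of forms and smoothing of functions -/

section Descent

variable {n : ℕ}
  {M : Type*} [TopologicalSpace M] [ChartedSpace (EuclideanSpace ℝ (Fin n)) M]
  {N : Type*} [TopologicalSpace N] [ChartedSpace (EuclideanSpace ℝ (Fin n)) N]
  {P : Type*} [TopologicalSpace P] [ChartedSpace (EuclideanSpace ℝ (Fin n)) P]
  {k : ℕ}

namespace DiffForm

theorem pullback_pullback {f : N → M} {h : P → N} {x : P} (η : DiffForm n M k)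
    (hf : MDifferentiableAt (𝓡 n) (𝓡 n) f (h x)) (hh : MDifferentiableAt (𝓡 n) (𝓡 n) h x) :
    (η.pullback f).pullback h x = η.pullback (f ∘ h) x :=
  comp_congr η rfl _ _ (mfderiv_comp x hf hh).symm

theorem pullback_congr {f f' : N → M} {x : N} (η : DiffForm n M k) (h : f =ᶠ[𝓝 x] f') :
    η.pullback f x = η.pullback f' x :=
  comp_congr η h.eq_of_nhds _ _ h.mfderiv_eq

theorem pullback_apply_congr {f : N → M} {x : N} {η ζ : DiffForm n M k} (h : η (f x) = ζ (f x)) :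
    η.pullback f x = ζ.pullback f x :=
  congrArg (fun a => ContinuousAlternatingMap.compContinuousLinearMap a
    (mfderiv (𝓡 n) (𝓡 n) f x)) h

theorem IsSmoothAt.congr {η ζ : DiffForm n M k} {x : M} (hη : η.IsSmoothAt x)
    (h : ∀ᶠ z in 𝓝 x, ζ z = η z) : ζ.IsSmoothAt x := by
  refine ContDiffAt.congr_of_eventuallyEq hη ?_
  have hφ : Filter.Tendsto (extChartAt (𝓡 n) x).symm (𝓝 (extChartAt (𝓡 n) x x)) (𝓝 x) := by
    have := continuousAt_extChartAt_symm (I := 𝓡 n) x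
    rwa [ContinuousAt, extChartAt_to_inv] at this
  filter_upwards [hφ.eventually h] with y hy
  exact congrArg (fun a => ContinuousAlternatingMap.compContinuousLinearMap a
    (mfderiv 𝓘(ℝ, EuclideanSpace ℝ (Fin n)) (𝓡 n) (extChartAt (𝓡 n) x).symm y)) hy

end DiffForm

namespace IsUniversalCovering

variable {p : N → M} (hp : IsUniversalCovering n p)
include hp

theorem contMDiff : ContMDiff (𝓡 n) (𝓡 n) ∞ p := hp.isLocalDiffeomorph.contMDiff

theorem surjective [ConnectedSpace M] : Function.Surjective p := by
  have := hp.simplyConnected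
  have : LocallyPathConnectedSpace M :=
    ChartedSpace.locallyPathConnectedSpace (EuclideanSpace ℝ (Fin n)) M
  have : PathConnectedSpace M := pathConnectedSpace_iff_connectedSpace.2 inferInstance
  exact hp.isCoveringMap.surjective_of_pathConnected

/-- A smooth section of the universal covering, on a neighbourhood of any point below. -/
theorem exists_section (x : N) : ∃ s : M → N, s (p x) = x ∧ ∃ V : Set M, IsOpen V ∧ p x ∈ V ∧
    ContMDiffOn (𝓡 n) (𝓡 n) ∞ s V ∧ ∀ y ∈ V, p (s y) = y :=
  let h := hp.isLocalDiffeomorph x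
  ⟨h.localInverse, h.localInverse_left_inv h.localInverse_mem_target, h.localInverse.source,
    h.localInverse_open_source, h.localInverse_mem_source, h.contmdiffOn_localInverse,
    fun _ hy => h.localInverse_right_inv hy⟩

/-- Deck transformations are only homeomorphisms by definition; locally they equal `s ∘ p` for a
smooth section `s` through the image point. -/
theorem contMDiff_smul (g : deckGroup p) : ContMDiff (𝓡 n) (𝓡 n) ∞ fun x : N => g • x := by
  intro x
  obtain ⟨s, hs, V, hV, hxV, hsV, hps⟩ := hp.exists_section (g • x)
  have hgx : p (g • x) = p x := deckGroup.map_smul g x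
  have h1 : ContMDiffAt (𝓡 n) (𝓡 n) ∞ (s ∘ p) x :=
    ContMDiffAt.comp x (hsV.contMDiffAt (hV.mem_nhds (hgx ▸ hxV))) hp.contMDiff.contMDiffAt
  refine h1.congr_of_eventuallyEq (deckGroup.eventuallyEq_of_comp_eventuallyEq hp.isCoveringMap
    (deckGroup.continuous_smul g).continuousAt h1.continuousAt ?_ ?_)
  · rw [Function.comp_apply, ← hgx, hs]
  · filter_upwards [hp.isCoveringMap.continuous.continuousAt.preimage_mem_nhds
      (hV.mem_nhds (hgx ▸ hxV))] with z hz
    exact (deckGroup.map_smul g z).trans (hps _ hz).symm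

variable [IsManifold (𝓡 n) ∞ M] [IsManifold (𝓡 n) ∞ N] [ConnectedSpace M]

/-- A smooth `1`-form invariant under deck transformations descends to the base. -/
theorem exists_pullback_eq {ζ : DiffForm n N 1} (hζ : ζ.IsSmooth)
    (hinv : ∀ g : deckGroup p, ζ.pullback (fun x => g • x) = ζ) :
    ∃ α : DiffForm n M 1, α.IsSmooth ∧ α.pullback p = ζ := by
  have := hp.simplyConnected
  have : LocallyPathConnectedSpace N :=
    ChartedSpace.locallyPathConnectedSpace (EuclideanSpace ℝ (Fin n)) N
  let σ : M → N := Function.surjInv hp.surjective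
  have hσ : ∀ y, p (σ y) = y := Function.surjInv_eq hp.surjective
  choose s hs V hV hxV hsV hps using hp.exists_section
  -- The section is chosen point by point; `hα` shows that any local section gives the same value,
  -- since two of them differ by a deck transformation.
  let α : DiffForm n M 1 := fun y => ζ.pullback (s (σ y)) y
  have hα : ∀ x, ∀ y ∈ V x, α y = ζ.pullback (s x) y := by
    intro x y hy
    have hy' : y ∈ V (σ y) := by simpa only [hσ] using hxV (σ y)
    have h1 := (hsV x).contMDiffAt ((hV x).mem_nhds hy)
    have h2 := (hsV (σ y)).contMDiffAt ((hV _).mem_nhds hy')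
    obtain ⟨g, hg⟩ := deckGroup.exists_eventuallyEq_smul hp.isCoveringMap h1.continuousAt
      h2.continuousAt (by
        filter_upwards [(hV x).mem_nhds hy, (hV _).mem_nhds hy'] with z hz hz'
        rw [hps x z hz, hps _ z hz'])
    calc α y = ζ.pullback ((fun x => g • x) ∘ s x) y := DiffForm.pullback_congr ζ hg
      _ = (ζ.pullback (fun x => g • x)).pullback (s x) y :=
        (DiffForm.pullback_pullback ζ ((hp.contMDiff_smul g).mdifferentiable (by simp) _)
          (h1.mdifferentiableAt (by simp))).symm
      _ = ζ.pullback (s x) y := by rw [hinv]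
  refine ⟨α, DiffForm.isSmooth_iff.2 fun y => ?_, funext fun x => ?_⟩
  · have hy' : y ∈ V (σ y) := by simpa only [hσ] using hxV (σ y)
    have h2 := (hsV (σ y)).contMDiffAt ((hV _).mem_nhds hy')
    refine ((hζ.isSmoothAt (s (σ y) y)).pullback h2).congr ?_
    filter_upwards [(hV _).mem_nhds hy'] with z hz using hα _ z hz
  · have h1 := (hsV x).contMDiffAt ((hV x).mem_nhds (hxV x))
    have hsp : s x ∘ p =ᶠ[𝓝 x] id :=
      deckGroup.eventuallyEq_of_comp_eventuallyEq hp.isCoveringMap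
        (ContinuousAt.comp h1.continuousAt hp.isCoveringMap.continuous.continuousAt)
        continuousAt_id (hs x) (by
          filter_upwards [hp.isCoveringMap.continuous.continuousAt.preimage_mem_nhds
            ((hV x).mem_nhds (hxV x))] with z hz
          exact hps x _ hz)
    calc α.pullback p x = (ζ.pullback (s x)).pullback p x :=
          DiffForm.pullback_apply_congr (hα x (p x) (hxV x))
      _ = ζ.pullback (s x ∘ p) x := DiffForm.pullback_pullback ζ
          (h1.mdifferentiableAt (by simp)) (hp.contMDiff.mdifferentiable (by simp) _)
      _ = ζ x := by rw [DiffForm.pullback_congr ζ hsp, DiffForm.pullback_id]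

omit [IsManifold (𝓡 n) ∞ M] [IsManifold (𝓡 n) ∞ N] in
/-- If the pullbacks of two forms to the universal covering agree, so do the forms. -/
theorem eq_of_pullback_eq {η ζ : DiffForm n M k} (h : η.pullback p = ζ.pullback p) : η = ζ := by
  funext y
  obtain ⟨x, rfl⟩ := hp.surjective y
  ext v
  let D := hp.isLocalDiffeomorph.mfderivToContinuousLinearEquiv (by simp) x
  have h1 := DFunLike.congr_fun (congrFun h x) (fun i => D.symm (v i))
  have h2 : ∀ w : TangentSpace (𝓡 n) (p x), mfderiv (𝓡 n) (𝓡 n) p x (D.symm w) = w :=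
    fun w => D.apply_symm_apply w
  change η (p x) (fun i => mfderiv (𝓡 n) (𝓡 n) p x (D.symm (v i))) =
    ζ (p x) (fun i => mfderiv (𝓡 n) (𝓡 n) p x (D.symm (v i))) at h1
  simpa only [h2] using h1

omit [IsManifold (𝓡 n) ∞ N] in
/-- A function whose changes under deck transformations are smooth becomes smooth after adding
an invariant function. -/
theorem exists_smooth_of_smooth_change [T2Space M] [CompactSpace M] (f : deckGroup p → N → ℝ)
    (hf : ∀ g, ContMDiff (𝓡 n) 𝓘(ℝ, ℝ) ∞ (f g)) (w : N → ℝ)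
    (hw : ∀ g : deckGroup p, ∃ c : ℝ, ∀ x, w (g • x) = w x - f g x + c) :
    ∃ w' : N → ℝ, ContMDiff (𝓡 n) 𝓘(ℝ, ℝ) ∞ w' ∧
      ∀ g : deckGroup p, ∃ c : ℝ, ∀ x, w' (g • x) = w' x - f g x + c := by
  have := hp.simplyConnected
  have : LocallyPathConnectedSpace N :=
    ChartedSpace.locallyPathConnectedSpace (EuclideanSpace ℝ (Fin n)) N
  choose s hs V hV hxV hsV hps using hp.exists_section
  obtain ⟨ρ, hρ⟩ := SmoothPartitionOfUnity.exists_isSubordinate (𝓡 n) (isClosed_univ (X := M)) V hV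
    (fun y _ => by
      obtain ⟨x, rfl⟩ := hp.surjective y
      exact Set.mem_iUnion.2 ⟨x, hxV x⟩)
  have hcont := hp.isCoveringMap.continuous
  -- This subtracts from `w` the deck-invariant average of its values on local sections. Where `s i
  -- ∘ p` is locally `g`, the bracket equals `f g - c`, hence is smooth although `w` need not be.
  refine ⟨fun x => ∑ᶠ i, ρ i (p x) * (w x - w (s i (p x))), ?_, fun g => ?_⟩
  · refine contMDiff_finsum (fun i x => ?_) ?_
    · by_cases hx : p x ∈ tsupport (ρ i)
      · have hxV' : p x ∈ V i := hρ i hx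
        have h1 : ContinuousAt (fun z => s i (p z)) x :=
          ContinuousAt.comp ((hsV i).continuousOn.continuousAt ((hV i).mem_nhds hxV'))
            hcont.continuousAt
        obtain ⟨g, hg⟩ := deckGroup.exists_eventuallyEq_smul hp.isCoveringMap
          continuousAt_id h1 (by
            filter_upwards [hcont.continuousAt.preimage_mem_nhds ((hV i).mem_nhds hxV')] with z hz
            exact (hps i _ hz).symm)
        obtain ⟨c, hc⟩ := hw g
        have h2 : ContMDiffAt (𝓡 n) 𝓘(ℝ, ℝ) ∞ (fun z => ρ i (p z) * (f g z - c)) x :=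
          (((ρ i).contMDiff.comp hp.contMDiff).mul ((hf g).sub contMDiff_const)).contMDiffAt
        refine h2.congr_of_eventuallyEq ?_
        filter_upwards [hg] with z hz
        rw [hz, id, hc]
        ring
      · refine (contMDiffAt_const (c := (0 : ℝ))).congr_of_eventuallyEq ?_
        filter_upwards [hcont.continuousAt.preimage_mem_nhds
          ((isClosed_tsupport (ρ i)).isOpen_compl.mem_nhds hx)] with z hz
        rw [image_eq_zero_of_notMem_tsupport hz, zero_mul]
    · refine (ρ.locallyFinite.preimage_continuous hcont).subset fun i x hx => ?_
      exact left_ne_zero_of_mul hx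
  · obtain ⟨c, hc⟩ := hw g
    refine ⟨c, fun x => ?_⟩
    have hfin : (Function.support fun i => ρ i (p x)).Finite := ρ.locallyFinite.point_finite (p x)
    have h1 : ∑ᶠ i, ρ i (p x) = 1 := ρ.sum_eq_one (Set.mem_univ _)
    have h2 : ∀ i, ρ i (p (g • x)) * (w (g • x) - w (s i (p (g • x)))) =
        ρ i (p x) * (w x - w (s i (p x))) + ρ i (p x) * (c - f g x) := fun i => by
      rw [deckGroup.map_smul (p := p), hc]
      ring
    simp only [h2]
    rw [finsum_add_distrib (hfin.subset fun i hi => left_ne_zero_of_mul hi)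
      (hfin.subset fun i hi => left_ne_zero_of_mul hi), ← finsum_mul, h1]
    ring

end IsUniversalCovering

theorem eq_of_mfderiv_eq_zero [IsManifold (𝓡 n) ∞ N] [PreconnectedSpace N] {f : N → ℝ}
    (hf : ∀ x, HasMFDerivAt (𝓡 n) 𝓘(ℝ, ℝ) f x 0) (x y : N) : f x = f y := by
  have h1 : IsLocallyConstant f := (IsLocallyConstant.iff_eventually_eq f).2 fun z =>
    eventually_eq_of_mfderiv_eventually_eq_zero (Filter.Eventually.of_forall hf)
  exact h1.apply_eq_of_preconnectedSpace x y

end Descent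

/-! ### From an invariant primitive to exactness -/

section InvariantPrimitive

variable {n : ℕ}
  {M : Type*} [TopologicalSpace M] [ChartedSpace (EuclideanSpace ℝ (Fin n)) M]
  [IsManifold (𝓡 n) ∞ M]
  {N : Type*} [TopologicalSpace N] [ChartedSpace (EuclideanSpace ℝ (Fin n)) N]
  [IsManifold (𝓡 n) ∞ N]
  {p : N → M} {Ω : DiffForm n M 2} {θ : DiffForm n N 1}

namespace IsUniversalCovering

omit [IsManifold (𝓡 n) ∞ M] in
/-- The change of a primitive of a lifted form under a deck transformation is closed. -/
theorem d_pullback_smul_sub (hp : IsUniversalCovering n p) (hθ : θ.IsPrimitive (Ω.pullback p))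
    (g : deckGroup p) : (θ.pullback (fun x => g • x) - θ).d = 0 := by
  have hg := hp.contMDiff_smul g
  funext x
  rw [DiffForm.d_sub ((hθ.1.isSmoothAt _).pullback hg.contMDiffAt) (hθ.1.isSmoothAt x),
    DiffForm.d_pullback (hθ.1.isSmoothAt _) hg.contMDiffAt, hθ.2,
    DiffForm.pullback_pullback Ω (hp.contMDiff.mdifferentiable (by simp) _)
      (hg.mdifferentiable (by simp) _),
    show p ∘ (fun x => g • x) = p from funext fun z => deckGroup.map_smul g z, sub_self]
  rfl

omit [IsManifold (𝓡 n) ∞ M] in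
/-- Primitives of the changes of a `1`-form under deck transformations form a cocycle up to
constants. -/
theorem primitive_cocycle [PreconnectedSpace N] (hp : IsUniversalCovering n p)
    {f : deckGroup p → N → ℝ}
    (hf : ∀ g x, HasMFDerivAt (𝓡 n) 𝓘(ℝ, ℝ) (f g) x
      ((θ.pullback (fun x => g • x) - θ).toCLM x)) (h g : deckGroup p) (x y : N) :
    f (h * g) x - f h (g • x) - f g x = f (h * g) y - f h (g • y) - f g y := by
  refine eq_of_mfderiv_eq_zero (n := n)
    (f := fun x => f (h * g) x - f h (g • x) - f g x) (fun z => ?_) x y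
  have hg := (hp.contMDiff_smul g).mdifferentiable (by simp) z
  have hh := (hp.contMDiff_smul h).mdifferentiable (by simp) (g • z)
  have h1 := ((hf (h * g) z).sub ((hf h (g • z)).comp z hg.hasMFDerivAt)).sub (hf g z)
  refine h1.congr_mfderiv (ContinuousLinearMap.ext fun v => ?_)
  -- Behind the cocycle: `(hg)^*θ - θ = g^*(h^*θ - θ) + (g^*θ - θ)`.
  have h2 : θ.pullback (fun x => (h * g) • x) z =
      (θ.pullback (fun x => h • x)).pullback (fun x => g • x) z := by
    rw [DiffForm.pullback_pullback θ hh hg]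
    exact DiffForm.pullback_congr θ (Filter.Eventually.of_forall fun w => mul_smul h g w)
  change (θ.pullback (fun x => (h * g) • x) z (fun _ => v) - θ z (fun _ => v)) -
    ((θ.pullback (fun x => h • x)).pullback (fun x => g • x) z (fun _ => v) -
      θ.pullback (fun x => g • x) z (fun _ => v)) -
    (θ.pullback (fun x => g • x) z (fun _ => v) - θ z (fun _ => v)) = 0
  rw [h2]
  ring

omit [IsManifold (𝓡 n) ∞ M] in
/-- Adding `dw` makes `θ` invariant under a deck transformation, if `dw` changes by the opposite
of the change of `θ`. -/
theorem pullback_smul_add_d_ofFun (hp : IsUniversalCovering n p) {w f : N → ℝ} {g : deckGroup p}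
    {c : ℝ} (hw : ContMDiff (𝓡 n) 𝓘(ℝ, ℝ) ∞ w)
    (hf : ∀ x, HasMFDerivAt (𝓡 n) 𝓘(ℝ, ℝ) f x ((θ.pullback (fun x => g • x) - θ).toCLM x))
    (hwg : ∀ x, w (g • x) = w x - f x + c) :
    (θ + (DiffForm.ofFun w).d).pullback (fun x => g • x) = θ + (DiffForm.ofFun w).d := by
  funext x
  refine DiffForm.ext_toCLM (ContinuousLinearMap.ext fun v => ?_)
  have hg := (hp.contMDiff_smul g).mdifferentiable (by simp) x
  have hwd : ∀ z, HasMFDerivAt (𝓡 n) 𝓘(ℝ, ℝ) w z (mfderiv (𝓡 n) 𝓘(ℝ, ℝ) w z) := fun z =>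
    (hw.mdifferentiable (by simp) z).hasMFDerivAt
  have h1 := (hwd (g • x)).comp x hg.hasMFDerivAt
  have h2 := ((hwd x).sub (hf x)).add (hasMFDerivAt_const (I := 𝓡 n) c x)
  have h3 : w ∘ (fun x => g • x) = (w - f) + fun _ => c := funext hwg
  rw [h3] at h1
  have h4 := DFunLike.congr_fun (hasMFDerivAt_unique h1 h2) v
  have h5 : (DiffForm.ofFun w).d (g • x)
        (fun _ => mfderiv (𝓡 n) (𝓡 n) (fun x => g • x) x v) =
      (DiffForm.ofFun w).d x (fun _ => v) - (θ.pullback (fun x => g • x) x (fun _ => v) -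
        θ x (fun _ => v)) + 0 := by
    rw [DiffForm.d_ofFun hw.contMDiffAt, DiffForm.d_ofFun hw.contMDiffAt]
    exact h4
  change θ.pullback (fun x => g • x) x (fun _ => v) + (DiffForm.ofFun w).d (g • x)
    (fun _ => mfderiv (𝓡 n) (𝓡 n) (fun x => g • x) x v) =
    θ x (fun _ => v) + (DiffForm.ofFun w).d x (fun _ => v)
  rw [h5]
  ring

/-- A form whose lift has a primitive that is invariant up to an exact form is exact. -/
theorem isExact_of_invariant [ConnectedSpace M] (hp : IsUniversalCovering n p)
    (hθ : θ.IsPrimitive (Ω.pullback p)) {w : N → ℝ} (hw : ContMDiff (𝓡 n) 𝓘(ℝ, ℝ) ∞ w)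
    (hinv : ∀ g : deckGroup p, (θ + (DiffForm.ofFun w).d).pullback (fun x => g • x) =
      θ + (DiffForm.ofFun w).d) : Ω.IsExact := by
  have hdw := DiffForm.isSmoothAt_d_ofFun hw
  have hζ : (θ + (DiffForm.ofFun w).d).IsSmooth :=
    DiffForm.isSmooth_iff.2 fun x => (hθ.1.isSmoothAt x).add (hdw x)
  obtain ⟨α, hα, hαp⟩ := hp.exists_pullback_eq hζ hinv
  refine ⟨α, hα, hp.eq_of_pullback_eq (funext fun x => ?_)⟩
  rw [← DiffForm.d_pullback (hα.isSmoothAt _) hp.contMDiff.contMDiffAt, hαp,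
    DiffForm.d_add (hθ.1.isSmoothAt x) (hdw x), hθ.2,
    DiffForm.d_d fun z => DiffForm.isSmoothAt_ofFun hw.contMDiffAt]
  exact add_zero _

end IsUniversalCovering

end InvariantPrimitive

end

/-- Let `M` be a closed connected manifold with Riemannian metric `g`, and `p : N → M` its
universal covering. If the fundamental group of `M` is amenable and the weakly exact 2-form `Ω`
is not exact, then the Mañé critical value of `(g, Ω)` is infinite (whichever primitive `θ` of the
lift of `Ω` is used to compute it). -/
theorem mainTheorem8 {n : ℕ}
    {M : Type*} [TopologicalSpace M] [ChartedSpace (EuclideanSpace ℝ (Fin n)) M]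
    [IsManifold (𝓡 n) ∞ M] [T2Space M] [CompactSpace M] [ConnectedSpace M]
    {N : Type*} [TopologicalSpace N] [ChartedSpace (EuclideanSpace ℝ (Fin n)) N]
    [IsManifold (𝓡 n) ∞ N] [T2Space N]
    (p : N → M) (hp : IsUniversalCovering n p)
    (g : RiemMetric n M)
    (Ω : DiffForm n M 2) (hΩ : Ω.IsSmooth)
    (hweak : Ω.IsWeaklyExact p)
    (x₀ : M) (hamenable : IsAmenableGroup (FundamentalGroup M x₀))
    (hnot : ¬ Ω.IsExact) :
    ∀ θ : DiffForm n N 1, θ.IsPrimitive (Ω.pullback p) → maneCriticalValue g p θ = ⊤ := by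

  intro θ hθ
  have := hp.simplyConnected
  have : LocallyPathConnectedSpace N :=
    ChartedSpace.locallyPathConnectedSpace (EuclideanSpace ℝ (Fin n)) N
  refine sInf_eq_top.2 ?_
  rintro _ ⟨k, hk, rfl⟩
  -- A single admissible real `k` already makes `Ω` exact, so the set of such `k` is empty.
  refine absurd ?_ hnot
  obtain ⟨e, he⟩ := hp.surjective x₀
  obtain ⟨u, hu⟩ := exists_potential (g := g) (k := k) hp.contMDiff hθ.1 hk
  have hprim := fun g : deckGroup p => DiffForm.exists_primitive
    (DiffForm.isSmooth_iff.2 fun x => ((hθ.1.isSmoothAt _).pullback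
      (hp.contMDiff_smul g).contMDiffAt).sub (hθ.1.isSmoothAt x)) (hp.d_pullback_smul_sub hθ g)
  choose f hfs hfd using hprim
  obtain ⟨w, hw⟩ := exists_averaged_primitive hamenable
    ((deckGroup.isQuotientCoveringMap hp.isCoveringMap hp.surjective).fundamentalGroupEquiv ⟨e, he⟩)
    e f u (fun x => by
      obtain ⟨C, hC⟩ := hu e x
      exact ⟨C, fun g => hC _ _ (hp.contMDiff_smul g)
        (funext fun z => deckGroup.map_smul g z) (hfd g)⟩)
    (fun h g x => hp.primitive_cocycle hfd h g x e)
  obtain ⟨w', hw's, hw'⟩ := hp.exists_smooth_of_smooth_change f hfs w hw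
  refine hp.isExact_of_invariant hθ hw's fun g => ?_
  obtain ⟨c, hc⟩ := hw' g
  exact hp.pullback_smul_add_d_ofFun hw's (hfd g) hc
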